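/- For integers $d,k\ge 1$ and a unitary $U\in U(d)$ with columns $\gamma_1,\dots,\gamma_d$, let $\mathcal M_k=\{\Pi_1,\dots,\Pi_k\}$ be the projective measurement on $\mathbb C^d$ obtained by splitting the orthonormal basis $(\gamma_t)$ into $k$ groups $G_1,\dots,G_k$ according to $t \bmod k$ (so each group has $d/k$ vectors if $k\mid d$, and $\lfloor d/k\rfloor$ or $\lceil d/k\rceil$ vectors in general), with $\Pi_j=\sum_{t\in G_j}\gamma_t\gamma_t^\dagger$. For a unit vector $\phi\in\mathbb C^d$, outcome $j$ of $\mathcal M_k$ has probability $\phi^\dagger\Pi_j\phi$. Let $D(\phi,\psi)=\sqrt{1-|\psi^\dagger\phi|^2}$ be the trace distance of pure states. For every $\delta_0<1$ there are constants $c,c_d,c_s>0$, depending only on $\delta_0$, such that the following holds. Let $\iota>0$, $\varepsilon>0$, $0<\delta\le\delta_0$, and let $d\ge 1$, $k\ge 1$, $N$ be integers with $$k\ \ge\ \frac{c\log(1/\delta)}{\iota^2},\qquad d\ \ge\ c_d\,k\log(1/\delta),\qquad N\ \ge\ \frac{c_s\,d\log(1/\delta)}{\varepsilon^2}.$$ Let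 $\phi,\psi\in\mathbb C^d$ be unit vectors. Draw $U$ from the Haar probability measure on $U(d)$, apply the resulting measurement $\mathcal M_k$ independently to each of $N$ copies of $\phi$ and each of $N$ copies of $\psi$, and let $\widetilde{\mathcal M}_k(\phi),\widetilde{\mathcal M}_k(\psi)\in\mathbb R^k$ be the empirical distributions of the outcomes. Then, with probability at least $1-\delta$ (over $U$ and the outcomes), $$(1-\iota)\,D(\phi,\psi)-\varepsilon\ \le\ \sqrt{\tfrac d2}\,\bigl\|\widetilde{\mathcal M}_k(\phi)-\widetilde{\mathcal M}_k(\psi)\bigr\|_2\ \le\ (1+\iota)\,D(\phi,\psi)+\varepsilon .$$ -/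

import Mathlib

open MeasureTheory
open scoped ComplexOrder

/-- A (POVM) measurement with `k` outcomes on `ℂ^d`: positive semidefinite effects that sum to
the identity. -/
structure Measurement (d k : ℕ) where
  effect : Fin k → Matrix (Fin d) (Fin d) ℂ
  posSemidef : ∀ j, (effect j).PosSemidef
  sum_eq_one : ∑ j, effect j = 1

namespace Measurement

variable {d k : ℕ}

/-- Born's rule: the probability `φ† Π_j φ` of outcome `j` when the state `φ` is measured. -/
noncomputable def prob (M : Measurement d k) (φ : EuclideanSpace ℂ (Fin d)) (j : Fin k) : ℝ :=
  (star φ.ofLp ⬝ᵥ (M.effect j).mulVec φ.ofLp).re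

theorem prob_nonneg (M : Measurement d k) (φ : EuclideanSpace ℂ (Fin d)) (j : Fin k) :
    0 ≤ M.prob φ j :=
  (M.posSemidef j).re_dotProduct_nonneg φ.ofLp

theorem sum_prob (M : Measurement d k) {φ : EuclideanSpace ℂ (Fin d)} (hφ : ‖φ‖ = 1) :
    ∑ j, M.prob φ j = 1 := by
  have h : ∑ j, M.prob φ j = (star φ.ofLp ⬝ᵥ (∑ j, M.effect j).mulVec φ.ofLp).re := by
    simp only [prob, ← Complex.re_sum, Matrix.sum_mulVec, dotProduct_sum]
  have h2 : (star φ.ofLp ⬝ᵥ φ.ofLp).re = ‖φ‖ ^ 2 := by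
    rw [EuclideanSpace.norm_sq_eq]
    simp [dotProduct, Complex.sq_norm, Complex.normSq_apply, Complex.mul_re]
  rw [h, M.sum_eq_one, Matrix.one_mulVec, h2, hφ, one_pow]

/-- The distribution `M(φ)` of the outcome of `M` on the state `φ`, as a measure on `Fin k`. -/
noncomputable def outcomeLaw (M : Measurement d k) (φ : EuclideanSpace ℂ (Fin d)) :
    Measure (Fin k) :=
  ∑ j, ENNReal.ofReal (M.prob φ j) • Measure.dirac j

instance (M : Measurement d k) (φ : EuclideanSpace ℂ (Fin d)) :
    IsFiniteMeasure (M.outcomeLaw φ) := by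
  constructor
  simp [outcomeLaw, ENNReal.sum_lt_top]

theorem outcomeLaw_singleton (M : Measurement d k) (φ : EuclideanSpace ℂ (Fin d)) (j : Fin k) :
    M.outcomeLaw φ {j} = ENNReal.ofReal (M.prob φ j) := by
  simp [outcomeLaw, Measure.dirac_apply' _ (measurableSet_singleton j), Set.indicator_apply]

theorem isProbabilityMeasure_outcomeLaw (M : Measurement d k) {φ : EuclideanSpace ℂ (Fin d)}
    (hφ : ‖φ‖ = 1) : IsProbabilityMeasure (M.outcomeLaw φ) := by
  constructor
  simp only [outcomeLaw, Measure.coe_finsetSum, Finset.sum_apply, Measure.smul_apply,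
    measure_univ, smul_eq_mul, mul_one]
  rw [← ENNReal.ofReal_sum_of_nonneg fun j _ => M.prob_nonneg φ j, M.sum_prob hφ,
    ENNReal.ofReal_one]

/-- The joint law of the outcomes when `M` is applied independently to each of `N` copies of
`φ`. -/
noncomputable def sampleLaw (M : Measurement d k) (N : ℕ) (φ : EuclideanSpace ℂ (Fin d)) :
    Measure (Fin N → Fin k) :=
  Measure.pi fun _ => M.outcomeLaw φ

end Measurement

/-- The trace distance `√(1 - |ψ†φ|²)` of two pure states. -/
noncomputable def traceDistance {d : ℕ} (φ ψ : EuclideanSpace ℂ (Fin d)) : ℝ :=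
  √(1 - ‖inner ℂ ψ φ‖ ^ 2)

/-- The empirical distribution of `N` outcomes, as a vector of `ℝ^k` with the `ℓ₂` norm. -/
noncomputable def empirical {N k : ℕ} (x : Fin N → Fin k) : EuclideanSpace ℝ (Fin k) :=
  WithLp.toLp 2 fun j => ((Finset.univ.filter fun i => x i = j).card : ℝ) / N

/-- The rank-one projection `γ_t γ_t†` onto the `t`-th column `γ_t` of a unitary matrix. -/
noncomputable def columnProj {d : ℕ} (U : Matrix.unitaryGroup (Fin d) ℂ) (t : Fin d) :
    Matrix (Fin d) (Fin d) ℂ :=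
  Matrix.vecMulVec (U.1.col t) (star (U.1.col t))

/-- The measurement that groups the orthonormal basis formed by the columns of `U` into `k`
groups, the vector number `t` going to the group `t mod k`, and projects onto the spans of the
groups. Every group has `d / k` vectors when `k ∣ d`, and `⌊d / k⌋` or `⌈d / k⌉` in general. -/
noncomputable def sketchMeasurement {d : ℕ} (k : ℕ) [NeZero k]
    (U : Matrix.unitaryGroup (Fin d) ℂ) : Measurement d k where
  effect j := ∑ t ∈ Finset.univ.filter (fun t : Fin d => Fin.ofNat k t.val = j), columnProj U t
  posSemidef j := by
    refine Matrix.posSemidef_sum _ fun t _ => ?_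
    exact Matrix.posSemidef_vecMulVec_self_star _
  sum_eq_one := by
    rw [Finset.sum_fiberwise]
    have h : U.1 * star U.1 = 1 := Unitary.coe_mul_star_self U
    rw [← h]
    ext a b
    simp [columnProj, Matrix.sum_apply, Matrix.vecMulVec_apply, Matrix.mul_apply,
      Matrix.star_apply]

section Haar

variable {d : ℕ}

noncomputable instance : MeasurableSpace (Matrix.unitaryGroup (Fin d) ℂ) := borel _

instance : BorelSpace (Matrix.unitaryGroup (Fin d) ℂ) := ⟨rfl⟩

instance : CompactSpace (Matrix.unitaryGroup (Fin d) ℂ) := by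
  refine isCompact_iff_compactSpace.mp ?_
  have hK : IsCompact (Set.univ.pi fun _ => Set.univ.pi fun _ => Metric.closedBall 0 1 :
      Set (Fin d → Fin d → ℂ)) :=
    isCompact_univ_pi fun _ => isCompact_univ_pi fun _ => isCompact_closedBall 0 1
  have hc : IsClosed ((Matrix.unitaryGroup (Fin d) ℂ : Submonoid _) :
      Set (Matrix (Fin d) (Fin d) ℂ)) := isClosed_unitary
  refine IsCompact.of_isClosed_subset hK hc fun U hU => ?_
  intro i _ j _
  rw [mem_closedBall_zero_iff]
  exact entry_norm_bound_of_unitary hU i j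

/-- The Haar probability measure on the unitary group `U(d)`. -/
noncomputable def haarUnitary (d : ℕ) : Measure (Matrix.unitaryGroup (Fin d) ℂ) :=
  Measure.haarMeasure ⊤

instance isProbabilityMeasure_haarUnitary : IsProbabilityMeasure (haarUnitary d) :=
  ⟨Measure.haarMeasure_self (K₀ := ⊤)⟩

/-- The joint law of the outcomes on `N` copies of `φ` and on `N` copies of `ψ`, for a fixed
measurement. -/
noncomputable def pairLaw {k : ℕ} (M : Measurement d k) (N : ℕ)
    (φ ψ : EuclideanSpace ℂ (Fin d)) : Measure ((Fin N → Fin k) × (Fin N → Fin k)) :=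
  (M.sampleLaw N φ).prod (M.sampleLaw N ψ)

theorem continuous_prob_sketchMeasurement (k : ℕ) [NeZero k] (φ : EuclideanSpace ℂ (Fin d))
    (j : Fin k) : Continuous fun U => (sketchMeasurement k U).prob φ j := by
  have h (t : Fin d) : Continuous fun U : Matrix.unitaryGroup (Fin d) ℂ => columnProj U t := by
    refine continuous_matrix fun a b => ?_
    simp only [columnProj, Matrix.vecMulVec_apply, Matrix.col_apply, Pi.star_apply]
    have hU (a b : Fin d) : Continuous fun U : Matrix.unitaryGroup (Fin d) ℂ => U.1 a b :=
      continuous_subtype_val.matrix_elem a b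
    exact (hU a t).mul (hU b t).star
  unfold Measurement.prob sketchMeasurement
  fun_prop

theorem measurable_pairLaw (k : ℕ) [NeZero k] (N : ℕ) {φ ψ : EuclideanSpace ℂ (Fin d)} :
    Measurable fun U => pairLaw (sketchMeasurement k U) N φ ψ := by
  refine Measure.measurable_of_measurable_coe _ fun s _ => ?_
  have hs (U : Matrix.unitaryGroup (Fin d) ℂ) : pairLaw (sketchMeasurement k U) N φ ψ s =
      ∑ z ∈ s.toFinite.toFinset, pairLaw (sketchMeasurement k U) N φ ψ {z} := by
    rw [sum_measure_singleton, Set.Finite.coe_toFinset]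
  simp only [hs]
  refine Finset.measurable_sum _ fun z _ => ?_
  have hz (U : Matrix.unitaryGroup (Fin d) ℂ) : pairLaw (sketchMeasurement k U) N φ ψ {z} =
      (∏ i, ENNReal.ofReal ((sketchMeasurement k U).prob φ (z.1 i))) *
        ∏ i, ENNReal.ofReal ((sketchMeasurement k U).prob ψ (z.2 i)) := by
    rw [pairLaw, ← Prod.mk.eta (p := z), ← Set.singleton_prod_singleton, Measure.prod_prod,
      Measurement.sampleLaw, Measurement.sampleLaw, Measure.pi_singleton, Measure.pi_singleton]
    simp only [Measurement.outcomeLaw_singleton]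
  simp only [hz]
  have hp (χ : EuclideanSpace ℂ (Fin d)) (j : Fin k) : Measurable fun U =>
      ENNReal.ofReal ((sketchMeasurement k U).prob χ j) :=
    (continuous_prob_sketchMeasurement k χ j).measurable.ennreal_ofReal
  exact (Finset.measurable_prod _ fun i _ => hp φ _).mul
    (Finset.measurable_prod _ fun i _ => hp ψ _)

/-- The experiment: draw one Haar-random unitary `U`, and apply the same measurement
`sketchMeasurement k U` independently to each of `N` copies of `φ` and `N` copies of `ψ`; this is
the law of the outcomes. -/
noncomputable def sketchLaw (k : ℕ) [NeZero k] (N : ℕ) (φ ψ : EuclideanSpace ℂ (Fin d)) :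
    Measure ((Fin N → Fin k) × (Fin N → Fin k)) :=
  (haarUnitary d).bind fun U => pairLaw (sketchMeasurement k U) N φ ψ

theorem isProbabilityMeasure_sketchLaw (k : ℕ) [NeZero k] (N : ℕ)
    {φ ψ : EuclideanSpace ℂ (Fin d)} (hφ : ‖φ‖ = 1) (hψ : ‖ψ‖ = 1) :
    IsProbabilityMeasure (sketchLaw k N φ ψ) := by
  refine isProbabilityMeasure_bind (measurable_pairLaw k N).aemeasurable (.of_forall fun U => ?_)
  have := (sketchMeasurement k U).isProbabilityMeasure_outcomeLaw hφ
  have := (sketchMeasurement k U).isProbabilityMeasure_outcomeLaw hψ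
  unfold pairLaw Measurement.sampleLaw
  infer_instance

end Haar

/-!
Up to a phase, `φφ† - ψψ† = D (ab† + ba†)` for an orthonormal pair `a`, `b` and the trace distance
`D` (`exists_orthogonal_blockInner_sub`). The difference of the outcome distributions for the
unitary `U` is therefore `2 D` times the vector `blockInner (U†a) (U†b)` of inner products of
`U†a` and `U†b` over the `k` blocks of coordinates, and it has to be shown that this vector has norm
`(1 ± ι) / √(2d)` for a random orthonormal pair.

Haar measure is traded for Gaussian measure: the unitary group is transitive on orthonormal pairs
and preserves the standard Gaussian law, so a Haar-random pair fails at most as often as the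
Gram-Schmidt pair of two independent Gaussian vectors `g`, `h` (`haarUnitary_lt_le_stdGaussian`).

Let `x = g / ‖g‖` and `h' = h - ⟪x, h⟫ x`. With `x` fixed, `blockInner x h'` is linear in `h`: its
main term `blockInner x h` has independent Gaussian entries of variances `q j = ‖x_j‖²`, where `x_j`
is the part of `x` in block `j`, and the correction term `Re ⟪x, h⟫ q` is small. As `∑ q j = 1`,
Bernstein's inequality for weighted sums of squares (`stdGaussian_le_abs_sum_inner_sq_sub`) gives
`‖blockInner x h‖ = 1 ± O(ι)`, as soon as `∑ q j ^ 2 = O(1 / k)` and no `q j` is too large; the same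
inequality controls `‖h'‖` and `⟪x, h⟫`. That `x` is flat in this sense follows from moments of
order `p = ⌊d / k⌋`, averaged over the blocks (`stdGaussian_lt_sum_blockInner_pow`). A union bound
over the blocks would cost a factor `k`, which the hypotheses do not allow when `k` is much larger
than a power of `1 / δ`.

Finally, for a fixed measurement, the empirical distribution of `N` outcomes is within
`O(√(log (1 / δ) / N))` of the true one in `ℓ²`, for every number of outcomes
(`Measurement.sampleLaw_le_norm_empirical_sub`): after symmetrization, the parallelogram law bounds
the moments `E cosh (l ‖∑ Yᵢ‖)` by `cosh (√2 l) ^ N`.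
-/

/-! ### Concentration of the empirical distribution -/

theorem pow_add_pow_le_of_sq_add_sq_eq {p q P M : ℝ} (hM : M ^ 2 ≤ P ^ 2) (hp : p ^ 2 ≤ P ^ 2)
    (hq : q ^ 2 ≤ P ^ 2) (h : p ^ 2 + q ^ 2 = P ^ 2 + M ^ 2) (n : ℕ) :
    p ^ (2 * n) + q ^ (2 * n) ≤ P ^ (2 * n) + M ^ (2 * n) := by
  rcases hM.eq_or_lt with hMP | hMP
  · have h1 : p ^ 2 = P ^ 2 := by linarith
    have h2 : q ^ 2 = M ^ 2 := by linarith
    rw [pow_mul, pow_mul, pow_mul P, pow_mul M, h1, h2]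
  · have hpos : 0 < P ^ 2 - M ^ 2 := by linarith
    -- `p²` and `q²` are the convex combinations of `P²` and `M²` with swapped weights
    obtain ⟨θ, hθ⟩ : ∃ θ, θ = (p ^ 2 - M ^ 2) / (P ^ 2 - M ^ 2) := ⟨_, rfl⟩
    have hθ0 : 0 ≤ θ := hθ ▸ div_nonneg (by linarith) hpos.le
    have hθ1 : θ ≤ 1 := by rw [hθ, div_le_one hpos]; linarith
    have e1 : p ^ 2 = θ * P ^ 2 + (1 - θ) * M ^ 2 := by rw [hθ]; field_simp; ring
    have e2 : q ^ 2 = (1 - θ) * P ^ 2 + θ * M ^ 2 := by linarith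
    have c1 := (convexOn_pow (𝕜 := ℝ) n).2 (sq_nonneg P) (sq_nonneg M) hθ0 (sub_nonneg.2 hθ1)
      (by ring)
    have c2 := (convexOn_pow (𝕜 := ℝ) n).2 (sq_nonneg P) (sq_nonneg M) (sub_nonneg.2 hθ1) hθ0
      (by ring)
    simp only [smul_eq_mul] at c1 c2
    rw [pow_mul, pow_mul, pow_mul P, pow_mul M, e1, e2]
    linarith

/-- A Hilbert space version of `cosh (a + b) + cosh (a - b) = 2 * cosh a * cosh b`: for given norms,
the left-hand side is largest when `s` and `y` are parallel. -/
theorem cosh_norm_add_add_cosh_norm_sub_le {E : Type*} [NormedAddCommGroup E]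
    [InnerProductSpace ℝ E] (l : ℝ) (s y : E) :
    Real.cosh (l * ‖s + y‖) + Real.cosh (l * ‖s - y‖) ≤
      2 * (Real.cosh (l * ‖s‖) * Real.cosh (l * ‖y‖)) := by
  have e : 2 * (Real.cosh (l * ‖s‖) * Real.cosh (l * ‖y‖)) =
      Real.cosh (l * (‖s‖ + ‖y‖)) + Real.cosh (l * (‖s‖ - ‖y‖)) := by
    rw [mul_add, mul_sub, Real.cosh_add, Real.cosh_sub]; ring
  rw [e]
  refine hasSum_le (fun n => ?_) ((Real.hasSum_cosh _).add (Real.hasSum_cosh _))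
    ((Real.hasSum_cosh _).add (Real.hasSum_cosh _))
  have hs := norm_nonneg s
  have hy := norm_nonneg y
  have hpar := parallelogram_law_with_norm ℝ s y
  have key := pow_add_pow_le_of_sq_add_sq_eq (p := ‖s + y‖) (q := ‖s - y‖) (P := ‖s‖ + ‖y‖)
    (M := ‖s‖ - ‖y‖) (by nlinarith) (pow_le_pow_left₀ (norm_nonneg _) (norm_add_le s y) 2)
    (pow_le_pow_left₀ (norm_nonneg _) (norm_sub_le s y) 2) (by nlinarith) n
  rw [← add_div, ← add_div]
  refine div_le_div_of_nonneg_right ?_ (Nat.cast_nonneg _)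
  simp only [mul_pow]
  rw [← mul_add, ← mul_add]
  exact mul_le_mul_of_nonneg_left key (by rw [pow_mul]; positivity)

theorem convexOn_cosh : ConvexOn ℝ Set.univ Real.cosh := by
  have h1 : ConvexOn ℝ Set.univ fun x : ℝ => Real.exp (-x) := by
    refine ⟨convex_univ, fun x _ y _ a b ha hb hab => ?_⟩
    have := convexOn_exp.2 (Set.mem_univ (-x)) (Set.mem_univ (-y)) ha hb hab
    simp only [smul_eq_mul] at this ⊢
    convert this using 2
    ring
  have h2 : Real.cosh = fun x => (1 / 2 : ℝ) • (Real.exp x + Real.exp (-x)) := by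
    ext x; rw [Real.cosh_eq]; simp only [smul_eq_mul]; ring
  rw [h2]
  exact (convexOn_exp.add h1).smul (by norm_num)

theorem cosh_norm_sum_smul_le {E : Type*} [NormedAddCommGroup E] [NormedSpace ℝ E] {κ : Type*}
    [Fintype κ] (p : κ → ℝ) (hp : ∀ j, 0 ≤ p j) (hp1 : ∑ j, p j = 1) (v : κ → E) (l : ℝ) :
    Real.cosh (l * ‖∑ j, p j • v j‖) ≤ ∑ j, p j * Real.cosh (l * ‖v j‖) := by
  have h1 : ‖∑ j, p j • v j‖ ≤ ∑ j, p j * ‖v j‖ := by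
    refine (norm_sum_le _ _).trans (Finset.sum_le_sum fun j _ => ?_)
    rw [norm_smul, Real.norm_of_nonneg (hp j)]
  have h0 : 0 ≤ ∑ j, p j * ‖v j‖ := (norm_nonneg _).trans h1
  have h2 : Real.cosh (l * ‖∑ j, p j • v j‖) ≤ Real.cosh (∑ j, p j • (l * ‖v j‖)) := by
    rw [Real.cosh_le_cosh]
    have : ∑ j, p j • (l * ‖v j‖) = l * ∑ j, p j * ‖v j‖ := by
      rw [Finset.mul_sum]; exact Finset.sum_congr rfl fun j _ => by simp only [smul_eq_mul]; ring
    rw [this, abs_mul, abs_mul, abs_of_nonneg (norm_nonneg _), abs_of_nonneg h0]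
    gcongr
  exact h2.trans (convexOn_cosh.map_sum_le (fun j _ => hp j) hp1 fun j _ => Set.mem_univ _)

/-- One step of the exponential bound, by symmetrization: the fluctuation `v j - ∑ l, p l • v l` is
dominated by the symmetric variable `v j - v l` with `j`, `l` independent. -/
theorem sum_mul_cosh_norm_add_sub_mean_le {E : Type*} [NormedAddCommGroup E]
    [InnerProductSpace ℝ E] {κ : Type*} [Fintype κ] (p : κ → ℝ) (hp : ∀ j, 0 ≤ p j)
    (hp1 : ∑ j, p j = 1) (v : κ → E) {b : ℝ} (hv : ∀ i j, ‖v i - v j‖ ≤ b) (l : ℝ) (s : E) :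
    ∑ j, p j * Real.cosh (l * ‖s + (v j - ∑ i, p i • v i)‖) ≤
      Real.cosh (l * ‖s‖) * Real.cosh (l * b) := by
  have h1 (j : κ) : Real.cosh (l * ‖s + (v j - ∑ i, p i • v i)‖) ≤
      ∑ i, p i * Real.cosh (l * ‖s + (v j - v i)‖) := by
    have : s + (v j - ∑ i, p i • v i) = ∑ i, p i • (s + (v j - v i)) := by
      simp only [smul_add, smul_sub, Finset.sum_add_distrib, Finset.sum_sub_distrib,
        ← Finset.sum_smul, hp1, one_smul]
    rw [this]
    exact cosh_norm_sum_smul_le p hp hp1 _ l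
  have h2 : ∑ j, p j * Real.cosh (l * ‖s + (v j - ∑ i, p i • v i)‖) ≤
      ∑ j, ∑ i, p j * p i * Real.cosh (l * ‖s + (v j - v i)‖) := by
    refine Finset.sum_le_sum fun j _ => (mul_le_mul_of_nonneg_left (h1 j) (hp j)).trans ?_
    rw [Finset.mul_sum]
    exact Finset.sum_le_sum fun i _ => by rw [mul_assoc]
  have h3 : ∑ j, ∑ i, p j * p i * Real.cosh (l * ‖s + (v j - v i)‖) =
      ∑ j, ∑ i, p j * p i * Real.cosh (l * ‖s - (v j - v i)‖) := by
    rw [Finset.sum_comm]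
    refine Finset.sum_congr rfl fun j _ => Finset.sum_congr rfl fun i _ => ?_
    rw [show s + (v i - v j) = s - (v j - v i) by abel, mul_comm (p i)]
  have h4 : 2 * ∑ j, ∑ i, p j * p i * Real.cosh (l * ‖s + (v j - v i)‖) ≤
      ∑ j, ∑ i, p j * p i * (2 * (Real.cosh (l * ‖s‖) * Real.cosh (l * b))) := by
    rw [two_mul]
    nth_rewrite 2 [h3]
    simp only [← Finset.sum_add_distrib, ← mul_add]
    refine Finset.sum_le_sum fun j _ => Finset.sum_le_sum fun i _ => ?_
    refine mul_le_mul_of_nonneg_left ?_ (mul_nonneg (hp j) (hp i))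
    refine (cosh_norm_add_add_cosh_norm_sub_le l s (v j - v i)).trans ?_
    have hb : Real.cosh (l * ‖v j - v i‖) ≤ Real.cosh (l * b) := by
      rw [Real.cosh_le_cosh, abs_mul, abs_mul, abs_of_nonneg (norm_nonneg (v j - v i)),
        abs_of_nonneg ((norm_nonneg _).trans (hv j i))]
      exact mul_le_mul_of_nonneg_left (hv j i) (abs_nonneg l)
    have := (Real.cosh_pos (l * ‖s‖)).le
    gcongr
  have h5 : ∑ j, ∑ i, p j * p i * (2 * (Real.cosh (l * ‖s‖) * Real.cosh (l * b))) =
      2 * (Real.cosh (l * ‖s‖) * Real.cosh (l * b)) := by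
    simp only [← Finset.sum_mul, ← Finset.mul_sum, hp1, one_mul, mul_one]
  linarith

theorem sum_prod_mul_cosh_norm_sum_le {E : Type*} [NormedAddCommGroup E]
    [InnerProductSpace ℝ E] {κ : Type*} [Fintype κ] (p : κ → ℝ) (hp : ∀ j, 0 ≤ p j)
    (hp1 : ∑ j, p j = 1) (v : κ → E) {b : ℝ} (hv : ∀ i j, ‖v i - v j‖ ≤ b) (l : ℝ) (N : ℕ)
    (s : E) :
    ∑ x : Fin N → κ, (∏ i, p (x i)) * Real.cosh (l * ‖s + ∑ i, (v (x i) - ∑ j, p j • v j)‖) ≤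
      Real.cosh (l * ‖s‖) * Real.cosh (l * b) ^ N := by
  induction N generalizing s with
  | zero => simp
  | succ N ih =>
    rw [← (Fin.consEquiv fun _ : Fin (N + 1) => κ).sum_comp, Fintype.sum_prod_type]
    simp only [Fin.consEquiv_apply, Fin.prod_univ_succ, Fin.sum_univ_succ, Fin.cons_zero,
      Fin.cons_succ]
    calc _ = ∑ j, p j * ∑ y : Fin N → κ, (∏ i, p (y i)) * Real.cosh (l *
          ‖(s + (v j - ∑ j, p j • v j)) + ∑ i, (v (y i) - ∑ j, p j • v j)‖) := by
          refine Finset.sum_congr rfl fun j _ => ?_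
          rw [Finset.mul_sum]
          refine Finset.sum_congr rfl fun y _ => ?_
          rw [mul_assoc, add_assoc]
      _ ≤ ∑ j, p j * (Real.cosh (l * ‖s + (v j - ∑ j, p j • v j)‖) * Real.cosh (l * b) ^ N) :=
          Finset.sum_le_sum fun j _ => mul_le_mul_of_nonneg_left (ih _) (hp j)
      _ = (∑ j, p j * Real.cosh (l * ‖s + (v j - ∑ j, p j • v j)‖)) * Real.cosh (l * b) ^ N := by
          rw [Finset.sum_mul]
          exact Finset.sum_congr rfl fun j _ => by rw [mul_assoc]
      _ ≤ Real.cosh (l * ‖s‖) * Real.cosh (l * b) * Real.cosh (l * b) ^ N := by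
          have := (Real.cosh_pos (l * b)).le
          gcongr
          exact sum_mul_cosh_norm_add_sub_mean_le p hp hp1 v hv l s
      _ = _ := by rw [pow_succ]; ring

namespace Measurement

variable {d k : ℕ}

/-- The vector of outcome probabilities of a measurement on a state. -/
noncomputable def probVec (M : Measurement d k) (φ : EuclideanSpace ℂ (Fin d)) :
    EuclideanSpace ℝ (Fin k) :=
  WithLp.toLp 2 (M.prob φ)

theorem isProbabilityMeasure_sampleLaw (M : Measurement d k) (N : ℕ)
    {φ : EuclideanSpace ℂ (Fin d)} (hφ : ‖φ‖ = 1) : IsProbabilityMeasure (M.sampleLaw N φ) := by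
  have := M.isProbabilityMeasure_outcomeLaw hφ
  unfold sampleLaw
  infer_instance

theorem sampleLaw_singleton (M : Measurement d k) (N : ℕ) (φ : EuclideanSpace ℂ (Fin d))
    (x : Fin N → Fin k) :
    M.sampleLaw N φ {x} = ENNReal.ofReal (∏ i, M.prob φ (x i)) := by
  rw [sampleLaw, Measure.pi_singleton, ENNReal.ofReal_prod_of_nonneg fun i _ => M.prob_nonneg φ _]
  simp only [outcomeLaw_singleton]

theorem norm_single_sub_single_le (i j : Fin k) :
    ‖EuclideanSpace.single i (1 : ℝ) - EuclideanSpace.single j 1‖ ≤ √2 := by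
  rcases eq_or_ne i j with rfl | h
  · simp
  · refine Real.le_sqrt_of_sq_le ?_
    rw [norm_sub_sq_real]
    simp [EuclideanSpace.inner_single_left, h]
    norm_num

theorem empirical_sub_probVec (M : Measurement d k) {N : ℕ} (hN : N ≠ 0)
    (φ : EuclideanSpace ℂ (Fin d)) (x : Fin N → Fin k) :
    (N : ℝ) • (empirical x - M.probVec φ) =
      ∑ i, (EuclideanSpace.single (x i) (1 : ℝ) -
        ∑ j, M.prob φ j • EuclideanSpace.single j 1) := by
  have hN' : (N : ℝ) ≠ 0 := by exact_mod_cast hN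
  ext j
  have h1 : ((Finset.univ.filter fun i => x i = j).card : ℝ) = ∑ i, if j = x i then 1 else 0 := by
    rw [Finset.card_filter]
    push_cast
    exact Finset.sum_congr rfl fun i _ => by simp only [eq_comm]
  have h2 : (∑ l, M.prob φ l • EuclideanSpace.single l (1 : ℝ)) j = M.prob φ j := by
    simp [Pi.single_apply]
  rw [PiLp.smul_apply, PiLp.sub_apply, WithLp.ofLp_sum, Finset.sum_apply]
  simp only [WithLp.ofLp_sub, Pi.sub_apply, h2, Finset.sum_sub_distrib, PiLp.single_apply,
    Finset.sum_const, Finset.card_univ, Fintype.card_fin, nsmul_eq_mul]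
  rw [← h1]
  simp only [empirical, probVec, smul_eq_mul]
  rw [mul_sub, mul_div_cancel₀ _ hN']

/-- The empirical distribution of `N` independent outcomes is within `r` of the true distribution
in `ℓ²`, up to a probability that does not depend on the number of outcomes. -/
theorem sampleLaw_le_norm_empirical_sub (M : Measurement d k) {N : ℕ} (hN : N ≠ 0)
    {φ : EuclideanSpace ℂ (Fin d)} (hφ : ‖φ‖ = 1) {r : ℝ} (hr : 0 ≤ r) :
    M.sampleLaw N φ {x | r ≤ ‖empirical x - M.probVec φ‖} ≤
      ENNReal.ofReal (2 * Real.exp (-(r ^ 2 * N / 4))) := by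
  classical
  set S : Set (Fin N → Fin k) := {x | r ≤ ‖empirical x - M.probVec φ‖} with hS
  have hN0 : (0 : ℝ) < N := by exact_mod_cast Nat.pos_of_ne_zero hN
  have e1 : M.sampleLaw N φ S = ∑ x ∈ S.toFinite.toFinset, M.sampleLaw N φ {x} := by
    rw [sum_measure_singleton, Set.Finite.coe_toFinset]
  have hw (x : Fin N → Fin k) : 0 ≤ ∏ i, M.prob φ (x i) :=
    Finset.prod_nonneg fun i _ => M.prob_nonneg φ _
  rw [e1]
  simp only [sampleLaw_singleton]
  rw [← ENNReal.ofReal_sum_of_nonneg fun x _ => hw x]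
  refine ENNReal.ofReal_le_ofReal ?_
  -- the exponent `r / 2` minimizes `N * l ^ 2 - N * l * r`
  set l : ℝ := r / 2 with hl
  have key := sum_prod_mul_cosh_norm_sum_le (M.prob φ) (M.prob_nonneg φ) (M.sum_prob hφ)
    (fun j => EuclideanSpace.single j (1 : ℝ)) norm_single_sub_single_le l N 0
  simp only [← M.empirical_sub_probVec hN, zero_add, norm_zero, mul_zero, Real.cosh_zero, one_mul,
    norm_smul, Real.norm_of_nonneg hN0.le] at key
  have h2 : Real.cosh (l * √2) ^ N ≤ Real.exp (N * l ^ 2) := by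
    rw [Real.exp_nat_mul]
    refine pow_le_pow_left₀ (Real.cosh_pos _).le ((Real.cosh_le_exp_half_sq _).trans ?_) N
    rw [mul_pow, Real.sq_sqrt (by norm_num)]
    apply Real.exp_le_exp.2; linarith
  have h3 : (∑ x ∈ S.toFinite.toFinset, ∏ i, M.prob φ (x i)) * (Real.exp (l * (N * r)) / 2) ≤
      ∑ x : Fin N → Fin k, (∏ i, M.prob φ (x i)) *
        Real.cosh (l * (N * ‖empirical x - M.probVec φ‖)) := by
    rw [Finset.sum_mul]
    refine (Finset.sum_le_sum fun x hx => ?_).trans (Finset.sum_le_sum_of_subset_of_nonneg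
      (Finset.subset_univ _) fun x _ _ => mul_nonneg (hw x) (Real.cosh_pos _).le)
    refine mul_le_mul_of_nonneg_left ?_ (hw x)
    have hx' : r ≤ ‖empirical x - M.probVec φ‖ := by simpa [hS] using hx
    have : Real.exp (l * (N * r)) ≤ Real.exp (l * (N * ‖empirical x - M.probVec φ‖)) := by
      apply Real.exp_le_exp.2
      have : 0 ≤ l := by positivity
      gcongr
    rw [Real.cosh_eq]
    have := Real.exp_pos (-(l * (N * ‖empirical x - M.probVec φ‖)))
    linarith
  have h4 := (h3.trans key).trans h2
  have h5 : Real.exp (-(r ^ 2 * N / 4)) = Real.exp (N * l ^ 2) / Real.exp (l * (N * r)) := by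
    rw [← Real.exp_sub]; congr 1; rw [hl]; ring
  rw [h5, ← mul_div_assoc, le_div_iff₀ (Real.exp_pos _)]
  linarith

end Measurement

/-! ### Quadratic forms of Gaussian vectors -/

theorem inv_sqrt_one_sub_le_exp {u : ℝ} (hu : |u| ≤ 1 / 2) :
    (√(1 - u))⁻¹ ≤ Real.exp (u / 2 + u ^ 2 / 2) := by
  obtain ⟨h1, h2⟩ := abs_le.1 hu
  have hpos : 0 < 1 - u := by linarith
  -- `log (1 - u) ≥ -u - u ^ 2`, from `exp (u + u ^ 2) ≥ 1 + (u + u ^ 2) + (u + u ^ 2) ^ 2 / 2`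
  -- when `u ≥ 0` and from `exp (u + u ^ 2) ≥ 1 + (u + u ^ 2)` when `u < 0`
  have key : 1 ≤ (1 - u) * Real.exp (u + u ^ 2) := by
    rcases le_total 0 u with h0 | h0
    · have := Real.quadratic_le_exp_of_nonneg (x := u + u ^ 2) (by positivity)
      refine le_trans ?_ (mul_le_mul_of_nonneg_left this hpos.le)
      nlinarith [mul_nonneg h0 h0, mul_nonneg (mul_nonneg h0 h0) h0,
        mul_nonneg (mul_nonneg h0 h0) (sub_nonneg.2 h2),
        mul_nonneg (mul_nonneg (mul_nonneg h0 h0) h0) (sub_nonneg.2 h2),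
        mul_nonneg (mul_nonneg (mul_nonneg (mul_nonneg h0 h0) h0) h0) (sub_nonneg.2 h2)]
    · have := Real.add_one_le_exp (u + u ^ 2)
      refine le_trans ?_ (mul_le_mul_of_nonneg_left this hpos.le)
      nlinarith [mul_nonneg (mul_nonneg (neg_nonneg.2 h0) (neg_nonneg.2 h0)) (neg_nonneg.2 h0)]
  rw [inv_le_iff_one_le_mul₀ (Real.sqrt_pos.2 hpos)]
  have e : Real.exp (u / 2 + u ^ 2 / 2) = √(Real.exp (u + u ^ 2)) := by
    rw [show u + u ^ 2 = (u / 2 + u ^ 2 / 2) + (u / 2 + u ^ 2 / 2) by ring,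
      Real.exp_add (u / 2 + u ^ 2 / 2),
      Real.sqrt_mul_self (Real.exp_pos _).le]
  rw [e, ← Real.sqrt_mul (Real.exp_pos _).le, mul_comm]
  exact Real.one_le_sqrt.2 key

namespace ProbabilityTheory

theorem integrable_exp_mul_sq_gaussianReal {v : NNReal} {a : ℝ} (h : 2 * a * v < 1) :
    Integrable (fun x => Real.exp (a * x ^ 2)) (gaussianReal 0 v) := by
  rcases eq_or_ne v 0 with rfl | hv
  · rw [gaussianReal_zero_var]
    exact integrable_dirac (by simp)
  · rw [gaussianReal_of_var_ne_zero _ hv, integrable_withDensity_iff_integrable_smul₀'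
      (measurable_gaussianPDF 0 v).aemeasurable
      (.of_forall fun x => ENNReal.ofReal_lt_top)]
    have hv0 : (0 : ℝ) < v := by exact_mod_cast pos_iff_ne_zero.2 hv
    have hb : 0 < 1 / (2 * (v : ℝ)) - a := by
      rw [sub_pos, lt_div_iff₀ (by positivity)]; linarith
    refine ((integrable_exp_neg_mul_sq hb).const_mul (√(2 * Real.pi * v))⁻¹).congr
      (.of_forall fun x => ?_)
    simp only [toReal_gaussianPDF, gaussianPDFReal, smul_eq_mul, sub_zero, mul_assoc,
      ← Real.exp_add]
    congr 3
    ring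

theorem integral_exp_mul_sq_gaussianReal {v : NNReal} {a : ℝ} (h : 2 * a * v < 1) :
    ∫ x, Real.exp (a * x ^ 2) ∂gaussianReal 0 v = (√(1 - 2 * a * v))⁻¹ := by
  rcases eq_or_ne v 0 with rfl | hv
  · simp [gaussianReal_zero_var]
  · have hv0 : (0 : ℝ) < v := by exact_mod_cast pos_iff_ne_zero.2 hv
    have hpos : 0 < 1 - 2 * a * v := by linarith
    rw [integral_gaussianReal_eq_integral_smul hv]
    have e (x : ℝ) : gaussianPDFReal 0 v x • Real.exp (a * x ^ 2) =
        (√(2 * Real.pi * v))⁻¹ * Real.exp (-(1 / (2 * (v : ℝ)) - a) * x ^ 2) := by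
      simp only [gaussianPDFReal, smul_eq_mul, sub_zero, mul_assoc, ← Real.exp_add]
      congr 3
      ring
    simp only [e]
    rw [integral_const_mul, integral_gaussian, ← Real.sqrt_inv, ← Real.sqrt_mul (by positivity),
      ← Real.sqrt_inv]
    congr 1
    have : 1 / (2 * (v : ℝ)) - a = (1 - 2 * a * v) / (2 * v) := by field_simp
    rw [this]
    field_simp

variable {E : Type*} [NormedAddCommGroup E] [InnerProductSpace ℝ E] [FiniteDimensional ℝ E]
  [MeasurableSpace E] [BorelSpace E]

theorem map_inner_stdGaussian (u : E) :
    (stdGaussian E).map (fun h => inner ℝ u h) = gaussianReal 0 (‖u‖ ^ 2).toNNReal := by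
  have h := IsGaussian.map_eq_gaussianReal (μ := stdGaussian E) (innerSL ℝ u)
  rw [integral_strongDual_stdGaussian, variance_dual_stdGaussian, innerSL_apply_norm] at h
  exact h

theorem iIndepFun_inner_stdGaussian {ι : Type*} [Finite ι] (f : ι → E)
    (hf : Pairwise fun i j => inner ℝ (f i) (f j) = 0) :
    iIndepFun (fun i h => inner ℝ (f i) h) (stdGaussian E) := by
  have := Fintype.ofFinite ι
  refine HasGaussianLaw.iIndepFun_of_covariance_eq_zero ?_ fun i j hij => ?_
  · exact IsGaussian.hasGaussianLaw_id.map
      (ContinuousLinearMap.pi fun i => (innerSL ℝ (f i) : E →L[ℝ] ℝ))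
  · rw [← covarianceBilin_apply_eq_cov IsGaussian.memLp_two_id, covarianceBilin_stdGaussian]
    exact hf hij

theorem integrable_exp_mul_inner_sq_stdGaussian (u : E) {a : ℝ} (ha : 4 * |a| * ‖u‖ ^ 2 ≤ 1) :
    Integrable (fun h => Real.exp (a * inner ℝ u h ^ 2)) (stdGaussian E) := by
  have h1 : 2 * a * (‖u‖ ^ 2).toNNReal < 1 := by
    rw [Real.coe_toNNReal _ (sq_nonneg _)]
    nlinarith [le_abs_self a, sq_nonneg ‖u‖, mul_nonneg (abs_nonneg a) (sq_nonneg ‖u‖)]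
  have h2 := integrable_exp_mul_sq_gaussianReal h1
  rw [← map_inner_stdGaussian u] at h2
  exact h2.comp_measurable (by fun_prop)

theorem mgf_inner_sq_stdGaussian_le (u : E) {a : ℝ} (ha : 4 * |a| * ‖u‖ ^ 2 ≤ 1) :
    mgf (fun h => inner ℝ u h ^ 2) (stdGaussian E) a ≤
      Real.exp (a * ‖u‖ ^ 2 + 2 * a ^ 2 * (‖u‖ ^ 2) ^ 2) := by
  have hv : ((‖u‖ ^ 2).toNNReal : ℝ) = ‖u‖ ^ 2 := Real.coe_toNNReal _ (sq_nonneg _)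
  have h1 : 2 * a * (‖u‖ ^ 2).toNNReal < 1 := by
    rw [hv]
    nlinarith [le_abs_self a, sq_nonneg ‖u‖, mul_nonneg (abs_nonneg a) (sq_nonneg ‖u‖)]
  have h2 : mgf (fun h => inner ℝ u h ^ 2) (stdGaussian E) a = (√(1 - 2 * a * ‖u‖ ^ 2))⁻¹ := by
    rw [← hv, ← integral_exp_mul_sq_gaussianReal h1, ← map_inner_stdGaussian u,
      integral_map (by fun_prop) (by fun_prop)]
    rfl
  rw [h2]
  refine (inv_sqrt_one_sub_le_exp ?_).trans (Real.exp_le_exp.2 (le_of_eq (by ring)))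
  rw [abs_mul, abs_mul, abs_of_nonneg (sq_nonneg ‖u‖), abs_two]
  linarith

variable {ι : Type*} [Fintype ι]

theorem integrable_exp_mul_sum_inner_sq (f : ι → E)
    (hf : Pairwise fun i j => inner ℝ (f i) (f j) = 0) {a : ℝ}
    (ha : ∀ i, 4 * |a| * ‖f i‖ ^ 2 ≤ 1) :
    Integrable (fun h => Real.exp (a * ∑ i, inner ℝ (f i) h ^ 2)) (stdGaussian E) := by
  have h1 := (iIndepFun_inner_stdGaussian f hf).comp (fun _ x => x ^ 2) (fun _ => by fun_prop)
  have h2 := h1.integrable_exp_mul_sum (t := a) (s := Finset.univ)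
    (fun i => by simp only [Function.comp_def]; fun_prop)
    fun i _ => integrable_exp_mul_inner_sq_stdGaussian (f i) (ha i)
  simpa only [Finset.sum_apply, Function.comp_apply] using h2

/-- For orthogonal vectors `f i`, the variables `⟪f i, h⟫` are independent centered Gaussians with
variances `‖f i‖ ^ 2`. -/
theorem mgf_sum_inner_sq_le (f : ι → E)
    (hf : Pairwise fun i j => inner ℝ (f i) (f j) = 0) {a : ℝ}
    (ha : ∀ i, 4 * |a| * ‖f i‖ ^ 2 ≤ 1) :
    mgf (fun h => ∑ i, inner ℝ (f i) h ^ 2) (stdGaussian E) a ≤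
      Real.exp (a * ∑ i, ‖f i‖ ^ 2 + 2 * a ^ 2 * ∑ i, (‖f i‖ ^ 2) ^ 2) := by
  have h1 := (iIndepFun_inner_stdGaussian f hf).comp (fun _ x => x ^ 2) (fun _ => by fun_prop)
  have h2 := h1.mgf_sum (t := a)
    (fun i => by simp only [Function.comp_def]; fun_prop) Finset.univ
  have h3 : (fun h => ∑ i, inner ℝ (f i) h ^ 2) =
      ∑ i, (fun x : ℝ => x ^ 2) ∘ fun h => inner ℝ (f i) h := by
    ext h; simp
  rw [h3, h2, Finset.mul_sum, Finset.mul_sum, ← Finset.sum_add_distrib, Real.exp_sum]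
  exact Finset.prod_le_prod (fun i _ => mgf_nonneg) fun i _ =>
    mgf_inner_sq_stdGaussian_le (f i) (ha i)

/-- Bernstein's inequality for a weighted sum of squares of independent Gaussians. -/
theorem stdGaussian_le_abs_sum_inner_sq_sub (f : ι → E)
    (hf : Pairwise fun i j => inner ℝ (f i) (f j) = 0) {a : ℝ} (ha0 : 0 ≤ a)
    (ha : ∀ i, 4 * a * ‖f i‖ ^ 2 ≤ 1) (t : ℝ) :
    (stdGaussian E).real {h | t ≤ |∑ i, inner ℝ (f i) h ^ 2 - ∑ i, ‖f i‖ ^ 2|} ≤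
      2 * Real.exp (-(a * t) + 2 * a ^ 2 * ∑ i, (‖f i‖ ^ 2) ^ 2) := by
  set V := ∑ i, ‖f i‖ ^ 2
  set W := ∑ i, (‖f i‖ ^ 2) ^ 2
  have hp : ∀ i, 4 * |a| * ‖f i‖ ^ 2 ≤ 1 := by simpa only [abs_of_nonneg ha0] using ha
  have hn : ∀ i, 4 * |-a| * ‖f i‖ ^ 2 ≤ 1 := by simpa only [abs_neg] using hp
  have u1 := measure_ge_le_exp_mul_mgf (V + t) ha0 (integrable_exp_mul_sum_inner_sq f hf hp)
  have u2 := measure_le_le_exp_mul_mgf (V - t) (neg_nonpos.2 ha0)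
    (integrable_exp_mul_sum_inner_sq f hf hn)
  have b1 := u1.trans (mul_le_mul_of_nonneg_left (mgf_sum_inner_sq_le f hf hp)
    (Real.exp_pos _).le)
  have b2 := u2.trans (mul_le_mul_of_nonneg_left (mgf_sum_inner_sq_le f hf hn)
    (Real.exp_pos _).le)
  rw [← Real.exp_add] at b1 b2
  have s : {h | t ≤ |∑ i, inner ℝ (f i) h ^ 2 - V|} ⊆
      {h | V + t ≤ ∑ i, inner ℝ (f i) h ^ 2} ∪ {h | ∑ i, inner ℝ (f i) h ^ 2 ≤ V - t} := by
    intro h hh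
    rcases le_abs.1 (show t ≤ |_| from hh) with h1 | h1
    · left; simp only [Set.mem_ofPred_eq]; linarith
    · right; simp only [Set.mem_ofPred_eq]; linarith
  refine (measureReal_mono s).trans ((measureReal_union_le _ _).trans ?_)
  have e1 : -a * (V + t) + (a * V + 2 * a ^ 2 * W) = -(a * t) + 2 * a ^ 2 * W := by ring
  have e2 : -(-a) * (V - t) + (-a * V + 2 * (-a) ^ 2 * W) = -(a * t) + 2 * a ^ 2 * W := by ring
  rw [e1] at b1
  rw [e2] at b2
  linarith

/-- The squared norm of a standard Gaussian vector concentrates around the dimension. -/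
theorem stdGaussian_le_abs_norm_sq_sub {a : ℝ} (ha0 : 0 ≤ a) (ha : 4 * a ≤ 1) (t : ℝ) :
    (stdGaussian E).real {h | t ≤ |‖h‖ ^ 2 - Module.finrank ℝ E|} ≤
      2 * Real.exp (-(a * t) + 2 * a ^ 2 * Module.finrank ℝ E) := by
  have h := stdGaussian_le_abs_sum_inner_sq_sub (stdOrthonormalBasis ℝ E)
    (fun i j hij => (stdOrthonormalBasis ℝ E).orthonormal.2 hij) ha0
    (fun i => by simpa using ha) t
  simpa [OrthonormalBasis.sum_sq_inner_right] using h

theorem stdGaussian_le_inner_sq {u : E} (hu : ‖u‖ = 1) {L : ℝ} (hL : 1 ≤ L) :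
    (stdGaussian E).real {h | 9 * L ≤ inner ℝ u h ^ 2} ≤ 2 * Real.exp (-L) := by
  have h := stdGaussian_le_abs_sum_inner_sq_sub (fun _ : Unit => u)
    (fun i j hij => (hij rfl).elim) (a := 1 / 4) (by norm_num) (fun i => by simp [hu]) (8 * L)
  simp only [Finset.univ_unique, Finset.sum_singleton, hu] at h
  refine (measureReal_mono fun x hx => ?_).trans (h.trans ?_)
  · have hx' : 9 * L ≤ inner ℝ u x ^ 2 := hx
    simp only [Set.mem_ofPred_eq]
    exact le_abs.2 (Or.inl (by linarith))
  · gcongr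
    linarith

end ProbabilityTheory

/-! ### Blocks of coordinates -/

section Block

variable {d k : ℕ}

/-- The inner products `∑ Re (conj (x t) * y t)` over the blocks `{t | κ t = j}` of coordinates, as
a vector indexed by the block number `j`. -/
noncomputable def blockInner (κ : Fin d → Fin k) (x y : EuclideanSpace ℂ (Fin d)) :
    EuclideanSpace ℝ (Fin k) :=
  WithLp.toLp 2 fun j => ∑ t with κ t = j, inner ℝ (x t) (y t)

/-- The vector `x` with all coordinates outside the block `{t | κ t = j}` set to zero. -/
noncomputable def blockPart (κ : Fin d → Fin k) (j : Fin k) (x : EuclideanSpace ℂ (Fin d)) :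
    EuclideanSpace ℂ (Fin d) :=
  WithLp.toLp 2 fun t => if κ t = j then x t else 0

variable (κ : Fin d → Fin k) (x y : EuclideanSpace ℂ (Fin d))

theorem inner_blockPart (j : Fin k) : inner ℝ (blockPart κ j x) y = blockInner κ x y j := by
  simp only [blockPart, blockInner, PiLp.inner_apply, Finset.sum_filter]
  refine Finset.sum_congr rfl fun t _ => ?_
  split_ifs
  · rfl
  · exact inner_zero_left _

theorem norm_sq_blockPart (j : Fin k) : ‖blockPart κ j x‖ ^ 2 = blockInner κ x x j := by
  rw [← real_inner_self_eq_norm_sq, inner_blockPart]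
  simp only [blockPart, blockInner]
  refine Finset.sum_congr rfl fun t ht => ?_
  rw [if_pos (Finset.mem_filter.1 ht).2]

theorem pairwise_inner_blockPart :
    Pairwise fun i j => inner ℝ (blockPart κ i x) (blockPart κ j x) = 0 := by
  intro i j hij
  rw [inner_blockPart]
  simp only [blockPart, blockInner]
  refine Finset.sum_eq_zero fun t ht => ?_
  rw [if_neg (by rw [(Finset.mem_filter.1 ht).2]; exact hij), inner_zero_right]

theorem blockInner_self_nonneg (j : Fin k) : 0 ≤ blockInner κ x x j := by
  rw [← norm_sq_blockPart]; positivity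

theorem sum_blockInner : ∑ j, blockInner κ x y j = inner ℝ x y := by
  simp only [blockInner, PiLp.inner_apply]
  exact Finset.sum_fiberwise _ _ _

theorem blockInner_smul_smul (a b : ℝ) :
    blockInner κ (a • x) (b • y) = (a * b) • blockInner κ x y := by
  ext j
  simp only [blockInner, PiLp.smul_apply, smul_eq_mul, Finset.mul_sum, real_inner_smul_left,
    real_inner_smul_right]
  exact Finset.sum_congr rfl fun t _ => by ring

theorem blockInner_sub_complex_smul (c : ℂ) :
    blockInner κ x (y - c • x) = blockInner κ x y - c.re • blockInner κ x x := by
  ext j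
  simp only [blockInner, PiLp.sub_apply, PiLp.smul_apply, smul_eq_mul, Finset.mul_sum,
    ← Finset.sum_sub_distrib, inner_sub_right]
  refine Finset.sum_congr rfl fun t _ => ?_
  simp only [Complex.inner, Complex.mul_re, Complex.mul_im, Complex.conj_re, Complex.conj_im]
  ring

theorem continuous_blockInner {X : Type*} [TopologicalSpace X]
    {f g : X → EuclideanSpace ℂ (Fin d)} (hf : Continuous f) (hg : Continuous g) :
    Continuous fun z => blockInner κ (f z) (g z) := by
  unfold blockInner
  refine (PiLp.continuous_toLp 2 _).comp (continuous_pi fun j => ?_)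
  refine continuous_finsetSum _ fun t _ => ?_
  exact ((PiLp.continuous_apply 2 _ t).comp hf).inner ((PiLp.continuous_apply 2 _ t).comp hg)

open ProbabilityTheory

/-- The real coordinates of a block: the vectors `e_t` and `i e_t` for `t` in the block, and zero
for the other indices `t`. -/
noncomputable def blockBasis (j : Fin k) (p : Fin d × Fin 2) : EuclideanSpace ℂ (Fin d) :=
  blockPart κ j (EuclideanSpace.single p.1 (if p.2 = 0 then 1 else Complex.I))

theorem inner_blockBasis (j : Fin k) (p : Fin d × Fin 2) (h : EuclideanSpace ℂ (Fin d)) :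
    inner ℝ (blockBasis κ j p) h =
      if κ p.1 = j then (if p.2 = 0 then (h p.1).re else (h p.1).im) else 0 := by
  rw [blockBasis, inner_blockPart]
  simp only [blockInner, Finset.sum_filter]
  rw [Finset.sum_eq_single p.1]
  · split_ifs <;> simp [Complex.inner]
  · intro t _ ht
    simp [ht]
  · simp

theorem sum_inner_blockBasis_sq (j : Fin k) (h : EuclideanSpace ℂ (Fin d)) :
    ∑ p, inner ℝ (blockBasis κ j p) h ^ 2 = blockInner κ h h j := by
  simp only [inner_blockBasis, blockInner, Finset.sum_filter, Fintype.sum_prod_type]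
  refine Finset.sum_congr rfl fun t _ => ?_
  split_ifs
  · rw [real_inner_self_eq_norm_sq, Complex.sq_norm, Complex.normSq_apply]
    simp [sq]
  · simp

theorem pairwise_inner_blockBasis (j : Fin k) :
    Pairwise fun p q => inner ℝ (blockBasis κ j p) (blockBasis κ j q) = 0 := by
  intro p q hpq
  rw [inner_blockBasis]
  simp only [blockBasis, blockPart, PiLp.single_apply]
  obtain ⟨t, b⟩ := p
  obtain ⟨t', b'⟩ := q
  rcases eq_or_ne t t' with rfl | ht
  · have hb : b ≠ b' := fun h => hpq (by rw [h])
    fin_cases b <;> fin_cases b' <;> simp_all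
  · simp [ht]

theorem norm_sq_blockBasis (j : Fin k) (p : Fin d × Fin 2) :
    ‖blockBasis κ j p‖ ^ 2 = if κ p.1 = j then 1 else 0 := by
  rw [← real_inner_self_eq_norm_sq, inner_blockBasis]
  simp only [blockBasis, blockPart, PiLp.single_apply]
  obtain ⟨t, b⟩ := p
  by_cases h : κ t = j <;> fin_cases b <;> simp [h]

theorem integrable_exp_blockInner (j : Fin k) :
    Integrable (fun g => Real.exp (1 / 4 * blockInner κ g g j))
      (stdGaussian (EuclideanSpace ℂ (Fin d))) := by
  have h := integrable_exp_mul_sum_inner_sq (blockBasis κ j) (pairwise_inner_blockBasis κ j)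
    (a := 1 / 4) fun p => by
      rw [norm_sq_blockBasis, abs_of_nonneg (by norm_num)]; split_ifs <;> norm_num
  simpa only [sum_inner_blockBasis_sq] using h

theorem integral_exp_blockInner_le (j : Fin k) :
    ∫ g, Real.exp (1 / 4 * blockInner κ g g j) ∂stdGaussian (EuclideanSpace ℂ (Fin d)) ≤
      Real.exp (3 / 4 * (Finset.univ.filter fun t => κ t = j).card) := by
  have h := mgf_sum_inner_sq_le (blockBasis κ j) (pairwise_inner_blockBasis κ j)
    (a := 1 / 4) fun p => by
      rw [norm_sq_blockBasis, abs_of_nonneg (by norm_num)]; split_ifs <;> norm_num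
  simp only [sum_inner_blockBasis_sq, norm_sq_blockBasis] at h
  refine h.trans (Real.exp_le_exp.2 (le_of_eq ?_))
  have e : ∑ p : Fin d × Fin 2, (if κ p.1 = j then (1 : ℝ) else 0) =
      2 * (Finset.univ.filter fun t => κ t = j).card := by
    rw [Fintype.sum_prod_type, Finset.card_filter]
    push_cast
    simp only [Fin.sum_univ_two, Finset.mul_sum]
    exact Finset.sum_congr rfl fun t _ => by ring
  simp only [ite_pow, one_pow, ne_eq, OfNat.ofNat_ne_zero, not_false_eq_true, zero_pow, e]
  ring

/-- A moment bound of order `p`, comparable to the size of the blocks, for the squared norms of the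
blocks of a Gaussian vector. Averaging over the blocks instead of taking a maximum keeps the
failure probability independent of the number of blocks. -/
theorem stdGaussian_lt_sum_blockInner_pow {p : ℕ} (hp : p ≠ 0) (hk : k ≠ 0)
    (hκ : ∀ j, (Finset.univ.filter fun t => κ t = j).card ≤ 2 * p) :
    (stdGaussian (EuclideanSpace ℂ (Fin d))).real
      {g | k * 50 ^ p < ∑ j, (blockInner κ g g j / p) ^ p} ≤ Real.exp (-p) := by
  have hp0 : (0 : ℝ) < p := by exact_mod_cast Nat.pos_of_ne_zero hp
  have hk0 : (0 : ℝ) < k := by exact_mod_cast Nat.pos_of_ne_zero hk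
  have hint : Integrable (fun g => ∑ j, 4 ^ p * Real.exp (1 / 4 * blockInner κ g g j))
      (stdGaussian (EuclideanSpace ℂ (Fin d))) :=
    integrable_finsetSum _ fun j _ => (integrable_exp_blockInner κ j).const_mul _
  have hm := mul_meas_ge_le_integral_of_nonneg (.of_forall fun g =>
    Finset.sum_nonneg fun j _ => by positivity) hint (k * 50 ^ p)
  have hI : ∫ g, ∑ j, 4 ^ p * Real.exp (1 / 4 * blockInner κ g g j)
      ∂stdGaussian (EuclideanSpace ℂ (Fin d)) ≤ k * (4 ^ p * Real.exp (3 / 2 * p)) := by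
    rw [integral_finsetSum _ fun j _ => (integrable_exp_blockInner κ j).const_mul _]
    refine (Finset.sum_le_card_nsmul _ _ (4 ^ p * Real.exp (3 / 2 * p)) fun j _ => ?_).trans
      (by simp)
    rw [integral_const_mul]
    refine mul_le_mul_of_nonneg_left ((integral_exp_blockInner_le κ j).trans ?_) (by positivity)
    apply Real.exp_le_exp.2
    have : ((Finset.univ.filter fun t => κ t = j).card : ℝ) ≤ 2 * p := by exact_mod_cast hκ j
    linarith
  have hsub : {g | k * 50 ^ p < ∑ j, (blockInner κ g g j / p) ^ p} ⊆
      {g | (k : ℝ) * 50 ^ p ≤ ∑ j, 4 ^ p * Real.exp (1 / 4 * blockInner κ g g j)} := by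
    intro g hg
    have hg' : (k : ℝ) * 50 ^ p < ∑ j, (blockInner κ g g j / p) ^ p := hg
    refine hg'.le.trans (Finset.sum_le_sum fun j _ => ?_)
    have h0 := blockInner_self_nonneg κ g j
    have h1 := Real.pow_div_factorial_le_exp (1 / 4 * blockInner κ g g j) (by positivity) p
    have h2 : (p.factorial : ℝ) ≤ p ^ p := by exact_mod_cast Nat.factorial_le_pow p
    rw [div_le_iff₀ (by positivity)] at h1
    rw [div_pow, div_le_iff₀ (by positivity)]
    calc blockInner κ g g j ^ p = 4 ^ p * (1 / 4 * blockInner κ g g j) ^ p := by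
          rw [← mul_pow]; congr 1; ring
      _ ≤ 4 ^ p * (Real.exp (1 / 4 * blockInner κ g g j) * p ^ p) := by
          gcongr
          exact h1.trans (mul_le_mul_of_nonneg_left h2 (Real.exp_pos _).le)
      _ = _ := by ring
  have hfin := mul_le_mul_of_nonneg_left (measureReal_mono hsub (μ := stdGaussian _))
    (by positivity : (0 : ℝ) ≤ k * 50 ^ p)
  have h50 : 4 ^ p * Real.exp (3 / 2 * p) ≤ 50 ^ p * Real.exp (-p) := by
    have e : Real.exp (5 / 2) ≤ 25 / 2 := by
      refine le_of_sq_le_sq ?_ (by norm_num)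
      rw [← Real.exp_nat_mul]
      have := Real.exp_one_lt_d9
      calc Real.exp (((2 : ℕ) : ℝ) * (5 / 2)) = Real.exp 1 ^ 5 := by
            rw [← Real.exp_nat_mul]; norm_num
        _ ≤ 2.7182818286 ^ 5 := by gcongr
        _ ≤ _ := by norm_num
    have e2 : Real.exp (3 / 2 * p) = Real.exp (5 / 2) ^ p * Real.exp (-p) := by
      rw [← Real.exp_nat_mul, ← Real.exp_add]; congr 1; ring
    rw [e2, ← mul_assoc, ← mul_pow]
    gcongr
    linarith
  have := (hfin.trans hm).trans (hI.trans (mul_le_mul_of_nonneg_left h50 hk0.le))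
  rw [← mul_assoc] at this
  exact le_of_mul_le_mul_left this (by positivity)

end Block

/-! ### The sketch of a Gaussian pair -/

section Flat

variable {k p : ℕ} {q : Fin k → ℝ} {L : ℝ}

theorem sum_sq_le_of_sum_pow_le (hk : k ≠ 0) (hp : 2 ≤ p) (hq : ∀ j, 0 ≤ q j)
    (h : ∑ j, (k * q j) ^ p ≤ k * 50 ^ p) : ∑ j, q j ^ 2 ≤ 5000 / k := by
  have hk0 : (0 : ℝ) < k := by exact_mod_cast Nat.pos_of_ne_zero hk
  have h1 (j : Fin k) : (k * q j) ^ 2 ≤ 2500 * (1 + (k * q j) ^ p / 50 ^ p) := by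
    have h0 : 0 ≤ k * q j / 50 := by have := hq j; positivity
    have h2 : (k * q j / 50) ^ 2 ≤ 1 + (k * q j / 50) ^ p := by
      rcases le_total (k * q j / 50) 1 with h3 | h3
      · have : (k * q j / 50) ^ 2 ≤ 1 := pow_le_one₀ h0 h3
        have : 0 ≤ (k * q j / 50) ^ p := by positivity
        linarith
      · have := pow_le_pow_right₀ h3 hp
        linarith
    rw [div_pow, div_pow] at h2
    linarith
  have h2 := Finset.sum_le_sum fun j (_ : j ∈ Finset.univ) => h1 j
  rw [← Finset.mul_sum, Finset.sum_add_distrib, ← Finset.sum_div] at h2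
  simp only [mul_pow, ← Finset.mul_sum, Finset.sum_const, Finset.card_univ, Fintype.card_fin,
    nsmul_eq_mul, mul_one] at h2 h
  have h5 : (k : ℝ) ^ p * (∑ j, q j ^ p) / 50 ^ p ≤ k := by
    rw [div_le_iff₀ (by positivity)]; exact h
  rw [le_div_iff₀ hk0]
  have h6 : (k : ℝ) * (k * ∑ j, q j ^ 2) ≤ k * 5000 := by nlinarith
  have := le_of_mul_le_mul_left h6 hk0
  linarith

/-- A moment of order `p ≥ L` controls the maximum: the loss `k ^ (1 / p)` is absorbed by `θ`, as
`k * θ ^ 2 ≤ L`. -/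
theorem mul_le_of_sum_pow_le (hk : k ≠ 0) (hp : 2 ≤ p) (hLp : L ≤ p) (hq : ∀ j, 0 ≤ q j)
    (h : ∑ j, (k * q j) ^ p ≤ k * 50 ^ p) {θ : ℝ} (hθ0 : 0 ≤ θ) (hθ1 : θ ≤ 1)
    (hθ : k * θ ^ 2 ≤ L) (j : Fin k) : k * θ * q j ≤ 150 := by
  have hk0 : (0 : ℝ) < k := by exact_mod_cast Nat.pos_of_ne_zero hk
  have h1 : (k * q j) ^ p ≤ k * 50 ^ p :=
    (Finset.single_le_sum (f := fun j => (k * q j) ^ p)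
      (fun i _ => by have := hq i; positivity) (Finset.mem_univ j)).trans h
  have h2 : (k : ℝ) * θ ^ p ≤ 3 ^ p := by
    calc (k : ℝ) * θ ^ p ≤ k * θ ^ 2 :=
          mul_le_mul_of_nonneg_left (pow_le_pow_of_le_one hθ0 hθ1 hp) hk0.le
      _ ≤ p := hθ.trans hLp
      _ ≤ Real.exp p := by linarith [Real.add_one_le_exp (p : ℝ)]
      _ = Real.exp 1 ^ p := by rw [← Real.exp_nat_mul, mul_one]
      _ ≤ 3 ^ p := by
          gcongr
          exact Real.exp_one_lt_three.le
  refine le_of_pow_le_pow_left₀ (n := p) (by omega) (by norm_num) ?_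
  calc (k * θ * q j) ^ p = θ ^ p * (k * q j) ^ p := by rw [← mul_pow]; congr 1; ring
    _ ≤ θ ^ p * (k * 50 ^ p) := mul_le_mul_of_nonneg_left h1 (by positivity)
    _ = (k * θ ^ p) * 50 ^ p := by ring
    _ ≤ 3 ^ p * 50 ^ p := mul_le_mul_of_nonneg_right h2 (by positivity)
    _ = 150 ^ p := by rw [← mul_pow]; norm_num

end Flat

section GaussianPair

open ProbabilityTheory

variable {d k : ℕ} (κ : Fin d → Fin k)

/-- For a unit vector `x` whose mass is spread evenly over the blocks, the sketch of `x` and a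
Gaussian vector has norm close to one. -/
theorem stdGaussian_le_abs_norm_sq_blockInner_sub (hk : k ≠ 0) {x : EuclideanSpace ℂ (Fin d)}
    (hx : ‖x‖ = 1) {p : ℕ} (hp : 2 ≤ p) {L : ℝ} (hL : 0 ≤ L) (hLp : L ≤ p)
    (h : ∑ j, (k * blockInner κ x x j) ^ p ≤ k * 50 ^ p) {η : ℝ} (hη : 0 ≤ η)
    (hηL : k * η ^ 2 = L) :
    (stdGaussian (EuclideanSpace ℂ (Fin d))).real
      {h | 620 * max η (η ^ 2) ≤ |‖blockInner κ x h‖ ^ 2 - 1|} ≤ 2 * Real.exp (-L) := by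
  have hk0 : (0 : ℝ) < k := by exact_mod_cast Nat.pos_of_ne_zero hk
  have hq := blockInner_self_nonneg κ x
  -- the exponent `k * θ / 600` is the optimal one, `k * η`, up to constants, capped at order `k`
  set θ := min η 1 with hθ
  have hθ0 : 0 ≤ θ := le_min hη zero_le_one
  have hθη : θ ^ 2 ≤ η ^ 2 := pow_le_pow_left₀ hθ0 (min_le_left _ _) 2
  have hmul : θ * max η (η ^ 2) = η ^ 2 := by
    rcases le_total η 1 with h1 | h1
    · rw [hθ, min_eq_left h1, max_eq_left (by nlinarith)]; ring
    · rw [hθ, min_eq_right h1, max_eq_right (by nlinarith)]; ring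
  have hmax := mul_le_of_sum_pow_le hk hp hLp hq h hθ0 (min_le_right _ _)
    (by rw [← hηL]; exact mul_le_mul_of_nonneg_left hθη hk0.le)
  have hsq := sum_sq_le_of_sum_pow_le hk hp hq h
  have hb := stdGaussian_le_abs_sum_inner_sq_sub (fun j => blockPart κ j x)
    (pairwise_inner_blockPart κ x) (a := k * θ / 600) (by positivity)
    (fun j => by rw [norm_sq_blockPart]; linarith [hmax j]) (620 * max η (η ^ 2))
  simp only [inner_blockPart, norm_sq_blockPart, sum_blockInner, real_inner_self_eq_norm_sq, hx,
    one_pow, ← EuclideanSpace.real_norm_sq_eq] at hb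
  refine hb.trans ?_
  gcongr
  have e1 : k * θ / 600 * (620 * max η (η ^ 2)) = 31 / 30 * L := by
    have : k * θ / 600 * (620 * max η (η ^ 2)) = 31 / 30 * (k * (θ * max η (η ^ 2))) := by ring
    rw [this, hmul, hηL]
  have e2 : 2 * (k * θ / 600) ^ 2 * ‖blockInner κ x x‖ ^ 2 ≤ L / 36 := by
    rw [EuclideanSpace.real_norm_sq_eq]
    calc _ ≤ 2 * (k * θ / 600) ^ 2 * (5000 / k) := by gcongr
      _ = k * θ ^ 2 / 36 := by field_simp; ring
      _ ≤ L / 36 := by rw [← hηL]; gcongr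
  rw [e1]
  linarith

/-- The component of `h` orthogonal to `g`, scaled by `‖g‖ ^ 2` so that it is a polynomial in
`g` and `h`. -/
noncomputable def orthPart (g h : EuclideanSpace ℂ (Fin d)) : EuclideanSpace ℂ (Fin d) :=
  ‖g‖ ^ 2 • h - inner ℂ g h • g

/-- The pair obtained from `g`, `h` by the Gram-Schmidt process exists and has a sketch of norm
`1 ± ι`, after scaling; stated without normalizing the vectors. -/
def GoodPair (ι : ℝ) (g h : EuclideanSpace ℂ (Fin d)) : Prop :=
  0 < ‖g‖ ∧ 0 < ‖orthPart g h‖ ∧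
    |√(2 * d) * ‖blockInner κ g (orthPart g h)‖ - ‖g‖ * ‖orthPart g h‖| ≤
      ι * (‖g‖ * ‖orthPart g h‖)

theorem continuous_orthPart : Continuous fun z : EuclideanSpace ℂ (Fin d) ×
    EuclideanSpace ℂ (Fin d) => orthPart z.1 z.2 := by
  unfold orthPart
  fun_prop

theorem measurableSet_goodPair (ι : ℝ) : MeasurableSet {z : EuclideanSpace ℂ (Fin d) ×
    EuclideanSpace ℂ (Fin d) | GoodPair κ ι z.1 z.2} := by
  have h1 : Continuous fun z : EuclideanSpace ℂ (Fin d) × EuclideanSpace ℂ (Fin d) => ‖z.1‖ :=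
    continuous_fst.norm
  have h2 := (continuous_orthPart (d := d)).norm
  have h3 := (continuous_blockInner κ continuous_fst (continuous_orthPart (d := d))).norm
  exact (measurableSet_lt measurable_const h1.measurable).inter
    ((measurableSet_lt measurable_const h2.measurable).inter
      (measurableSet_le ((continuous_const.mul h3).sub (h1.mul h2)).abs.measurable
        (continuous_const.mul (h1.mul h2)).measurable))

theorem orthPart_smul {x : EuclideanSpace ℂ (Fin d)} (hx : ‖x‖ = 1) {n : ℝ} (hn : 0 ≤ n)
    (h : EuclideanSpace ℂ (Fin d)) :
    orthPart (n • x) h = n ^ 2 • (h - inner ℂ x h • x) := by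
  ext t
  simp only [orthPart, norm_smul, hx, mul_one, Real.norm_of_nonneg hn, PiLp.sub_apply,
    PiLp.smul_apply, smul_eq_mul, Complex.real_smul]
  have : inner ℂ (n • x) h = (n : ℂ) * inner ℂ x h := by
    rw [← Complex.coe_smul n x, inner_smul_left, Complex.conj_ofReal]
  rw [this]
  push_cast
  ring

theorem norm_sq_sub_inner_smul {x : EuclideanSpace ℂ (Fin d)} (hx : ‖x‖ = 1)
    (h : EuclideanSpace ℂ (Fin d)) :
    ‖h - inner ℂ x h • x‖ ^ 2 = ‖h‖ ^ 2 - ‖inner ℂ x h‖ ^ 2 := by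
  have horth : inner ℂ (h - inner ℂ x h • x) (inner ℂ x h • x) = 0 := by
    rw [inner_sub_left, inner_smul_right, inner_smul_right, inner_smul_left,
      inner_self_eq_norm_sq_to_K, hx, ← inner_conj_symm h x]
    simp
  have := norm_add_sq_eq_norm_sq_add_norm_sq_of_inner_eq_zero _ _ horth
  rw [sub_add_cancel, norm_smul, hx, mul_one] at this
  linarith

theorem goodPair_smul {x : EuclideanSpace ℂ (Fin d)} (hx : ‖x‖ = 1) {n ι : ℝ} (hn : 0 < n)
    {h : EuclideanSpace ℂ (Fin d)} (h0 : 0 < ‖h - inner ℂ x h • x‖)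
    (h1 : |√(2 * d) * ‖blockInner κ x (h - inner ℂ x h • x)‖ - ‖h - inner ℂ x h • x‖| ≤
      ι * ‖h - inner ℂ x h • x‖) : GoodPair κ ι (n • x) h := by
  have e1 : ‖n • x‖ = n := by rw [norm_smul, hx, mul_one, Real.norm_of_nonneg hn.le]
  unfold GoodPair
  rw [orthPart_smul hx hn.le, blockInner_smul_smul, e1, norm_smul, norm_smul,
    Real.norm_of_nonneg (by positivity), Real.norm_of_nonneg (by positivity)]
  refine ⟨hn, by positivity, ?_⟩
  have e2 : √(2 * d) * (n * n ^ 2 * ‖blockInner κ x (h - inner ℂ x h • x)‖) -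
      n * (n ^ 2 * ‖h - inner ℂ x h • x‖) = n ^ 3 *
        (√(2 * d) * ‖blockInner κ x (h - inner ℂ x h • x)‖ - ‖h - inner ℂ x h • x‖) := by ring
  rw [e2, abs_mul, abs_of_pos (by positivity)]
  calc _ ≤ n ^ 3 * (ι * ‖h - inner ℂ x h • x‖) := by gcongr
    _ = _ := by ring

theorem abs_sub_one_le_of_abs_sq_sub_one_le {η W : ℝ} (hη : 0 ≤ η) (hW0 : 0 ≤ W)
    (hW : |W ^ 2 - 1| ≤ 620 * max η (η ^ 2)) : |W - 1| ≤ 620 * η := by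
  obtain ⟨a1, a2⟩ := abs_le.1 hW
  rcases le_total η 1 with h1 | h1
  · rw [max_eq_left (by nlinarith)] at a1 a2
    refine abs_le.2 ⟨?_, ?_⟩
    · by_contra! hc
      nlinarith
    · nlinarith
  · rw [max_eq_right (by nlinarith)] at a1 a2
    refine abs_le.2 ⟨by linarith, ?_⟩
    refine le_of_sub_nonneg ?_
    by_contra! hc
    nlinarith

/-- The deterministic part of the estimate. For a unit vector `x` and a Gaussian vector `h` with
component `h' = h - ⟪x, h⟫ x`, the letters stand for `A = ‖blockInner x h'‖`,
`W = ‖blockInner x h‖`, `R = ‖blockInner x (h - h')‖`, `H = ‖h'‖`, `G = ‖h‖ ^ 2` and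
`s = |⟪x, h⟫| ^ 2`. -/
theorem abs_sqrt_mul_sub_le {d k L η A W R H G s : ℝ} (hk : 1 ≤ k) (hL : 1 ≤ L) (hη : 0 ≤ η)
    (hηL : k * η ^ 2 = L) (hd : 676 * k * L ≤ d) (hW0 : 0 ≤ W) (hH : 0 ≤ H)
    (hW : |W ^ 2 - 1| ≤ 620 * max η (η ^ 2)) (hR : R ≤ 213 * η) (hAW : |A - W| ≤ R)
    (hG : |G - 2 * d| ≤ 8 * √(d * L)) (hs0 : 0 ≤ s) (hs : s ≤ 18 * L) (hHG : H ^ 2 = G - s) :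
    0 < H ∧ |√(2 * d) * A - H| ≤ 1700 * η * H := by
  have hd0 : 0 < d := by nlinarith
  have hW1 := abs_sub_one_le_of_abs_sq_sub_one_le hη hW0 hW
  -- `e ^ 2 = L / d` is both at most `(1 / 26) ^ 2` and at most `(η / 26) ^ 2`
  obtain ⟨e, he⟩ : ∃ e, e = √(L / d) := ⟨_, rfl⟩
  have he0 : 0 ≤ e := he ▸ Real.sqrt_nonneg _
  have he2 : d * e ^ 2 = L := by
    rw [he, Real.sq_sqrt (by positivity)]; field_simp
  have hde : √(d * L) = d * e := by
    rw [← he2, show d * (d * e ^ 2) = (d * e) ^ 2 by ring, Real.sqrt_sq (by positivity)]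
  have he1 : 26 * e ≤ 1 := by
    refine le_of_sq_le_sq ?_ zero_le_one
    have : d * (676 * e ^ 2) ≤ d * 1 := by nlinarith
    have := le_of_mul_le_mul_left this hd0
    linarith
  have heη : 26 * e ≤ η := by
    refine le_of_sq_le_sq ?_ hη
    have h1 : k * (676 * (d * e ^ 2)) ≤ d * (k * η ^ 2) := by rw [he2, hηL]; nlinarith
    have h2 : (k * d) * (676 * e ^ 2) ≤ (k * d) * η ^ 2 := by linarith
    have := le_of_mul_le_mul_left h2 (by positivity)
    linarith
  obtain ⟨S, hS⟩ : ∃ S, S = √(2 * d) := ⟨_, rfl⟩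
  have hS0 : 0 < S := hS ▸ Real.sqrt_pos.2 (by positivity)
  have hS2 : S ^ 2 = 2 * d := by rw [hS, Real.sq_sqrt (by positivity)]
  obtain ⟨r, hr⟩ : ∃ r, r = H / S := ⟨_, rfl⟩
  have hr0 : 0 ≤ r := hr ▸ div_nonneg hH hS0.le
  have hHr : H = S * r := by rw [hr]; field_simp
  have hr2 : |r ^ 2 - 1| ≤ 13 * e := by
    have h1 : 2 * d * r ^ 2 = G - s := by rw [← hHG, hHr, mul_pow, hS2]
    rw [hde] at hG
    obtain ⟨g1, g2⟩ := abs_le.1 hG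
    rw [← he2] at hs
    have hee : d * e ^ 2 ≤ d * e := by
      refine mul_le_mul_of_nonneg_left ?_ hd0.le
      nlinarith
    refine abs_le.2 ⟨?_, ?_⟩
    · have : (2 * d) * (-(13 * e)) ≤ (2 * d) * (r ^ 2 - 1) := by nlinarith
      exact le_of_mul_le_mul_left this (by positivity)
    · have : (2 * d) * (r ^ 2 - 1) ≤ (2 * d) * (13 * e) := by nlinarith
      exact le_of_mul_le_mul_left this (by positivity)
  have hr1 : |r - 1| ≤ 13 * e := by
    refine le_trans ?_ hr2
    have : r ^ 2 - 1 = (r - 1) * (r + 1) := by ring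
    rw [this, abs_mul, abs_of_nonneg (by linarith : 0 ≤ r + 1)]
    exact le_mul_of_one_le_right (abs_nonneg _) (by linarith)
  obtain ⟨b1, b2⟩ := abs_le.1 hr1
  have hrhalf : 1 / 2 ≤ r := by linarith
  rw [← hS, hHr]
  refine ⟨by positivity, ?_⟩
  have hAr : |A - r| ≤ 834 * η := by
    calc |A - r| = |(A - W) + ((W - 1) - (r - 1))| := by congr 1; ring
      _ ≤ |A - W| + |(W - 1) - (r - 1)| := abs_add_le _ _
      _ ≤ |A - W| + (|W - 1| + |r - 1|) := by gcongr; exact abs_sub _ _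
      _ ≤ 834 * η := by linarith
  rw [← mul_sub, abs_mul, abs_of_pos hS0]
  calc S * |A - r| ≤ S * (834 * η) := by gcongr
    _ ≤ S * (1700 * η * r) := by
        refine mul_le_mul_of_nonneg_left ?_ hS0.le
        nlinarith
    _ = _ := by ring

theorem finrank_real_euclideanSpace_complex :
    Module.finrank ℝ (EuclideanSpace ℂ (Fin d)) = 2 * d := by
  rw [← Module.finrank_mul_finrank ℝ ℂ, Complex.finrank_real_complex, finrank_euclideanSpace_fin]

theorem stdGaussian_le_abs_norm_sq_sub_two_mul {L : ℝ} (hL : 0 ≤ L) (hd : L ≤ d) :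
    (stdGaussian (EuclideanSpace ℂ (Fin d))).real
      {h | 8 * √(d * L) ≤ |‖h‖ ^ 2 - 2 * d|} ≤ 2 * Real.exp (-L) := by
  rcases hL.eq_or_lt with rfl | hL0
  · exact measureReal_le_one.trans (by simp)
  have hd0 : (0 : ℝ) < d := hL0.trans_le hd
  have h := stdGaussian_le_abs_norm_sq_sub (E := EuclideanSpace ℂ (Fin d)) (a := √(L / d) / 4)
    (by positivity) (by
      have : √(L / d) ≤ 1 := Real.sqrt_le_one.2 ((div_le_one hd0).2 hd)
      linarith) (8 * √(d * L))
  rw [finrank_real_euclideanSpace_complex] at h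
  push_cast at h
  refine h.trans ?_
  gcongr
  have e1 : √(L / d) / 4 * (8 * √(d * L)) = 2 * L := by
    have : √(L / d) * √(d * L) = L := by
      rw [← Real.sqrt_mul (by positivity), show L / d * (d * L) = L ^ 2 by field_simp,
        Real.sqrt_sq hL]
    linarith
  have e2 : 2 * (√(L / d) / 4) ^ 2 * (2 * d) = L / 4 := by
    rw [div_pow, Real.sq_sqrt (by positivity)]; field_simp; norm_num
  rw [e1, e2]
  linarith

end GaussianPair

theorem lintegral_le_measure_add {α : Type*} [MeasurableSpace α] (μ : Measure α)
    [IsProbabilityMeasure μ] {f : α → ENNReal} (hf : ∀ x, f x ≤ 1) (S : Set α) (c : ENNReal)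
    (hc : ∀ x, x ∉ S → f x ≤ c) : ∫⁻ x, f x ∂μ ≤ μ S + c := by
  calc ∫⁻ x, f x ∂μ ≤ ∫⁻ x, ((toMeasurable μ S).indicator 1 x + c) ∂μ := by
        refine lintegral_mono fun x => ?_
        by_cases hx : x ∈ toMeasurable μ S
        · rw [Set.indicator_of_mem hx]
          exact (hf x).trans le_self_add
        · rw [Set.indicator_of_notMem hx, zero_add]
          exact hc x fun h => hx (subset_toMeasurable μ S h)
    _ = μ S + c := by
        rw [lintegral_add_right _ measurable_const, lintegral_indicator_one
          (measurableSet_toMeasurable μ S), measure_toMeasurable, lintegral_const, measure_univ,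
          mul_one]

section GaussianPair

open ProbabilityTheory

variable {d k : ℕ} (κ : Fin d → Fin k)

theorem real_inner_eq_re_inner_complex (x y : EuclideanSpace ℂ (Fin d)) :
    inner ℝ x y = (inner ℂ x y).re := by
  simp only [PiLp.inner_apply, Complex.re_sum]
  refine Finset.sum_congr rfl fun t _ => ?_
  simp [Complex.inner, mul_comm]

/-- If `g` is long and its mass is spread evenly over the blocks, then `(g, h)` is a good pair for
most Gaussian vectors `h`. -/
theorem stdGaussian_not_goodPair {g : EuclideanSpace ℂ (Fin d)} {L ι : ℝ} {p : ℕ} (hk : k ≠ 0)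
    (hL : 1 ≤ L) (hι : 0 ≤ ι) (hkι : 1700 ^ 2 * L ≤ ι ^ 2 * k) (hd : 676 * k * L ≤ d)
    (hp : 2 ≤ p) (hLp : L ≤ p) (hpd : k * p ≤ d) (hg : d ≤ ‖g‖ ^ 2)
    (hflat : ∑ j, (blockInner κ g g j / p) ^ p ≤ k * 50 ^ p) :
    (stdGaussian (EuclideanSpace ℂ (Fin d))).real {h | ¬ GoodPair κ ι g h} ≤
      8 * Real.exp (-L) := by
  have hk1 : (1 : ℝ) ≤ k := by exact_mod_cast Nat.one_le_iff_ne_zero.2 hk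
  have hk0 : (0 : ℝ) < k := by linarith
  have hd0 : (0 : ℝ) < d := by nlinarith
  have hpd' : (k : ℝ) * p ≤ d := by exact_mod_cast hpd
  have hp0 : (0 : ℝ) < p := by linarith
  have hg0 : 0 < ‖g‖ := by
    rcases (norm_nonneg g).eq_or_lt with h | h
    · rw [← h] at hg; linarith [zero_pow (M₀ := ℝ) two_ne_zero]
    · exact h
  obtain ⟨x, hx⟩ : ∃ x, x = ‖g‖⁻¹ • g := ⟨_, rfl⟩
  have hx1 : ‖x‖ = 1 := by
    rw [hx, norm_smul, norm_inv, norm_norm, inv_mul_cancel₀ hg0.ne']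
  have hgx : g = ‖g‖ • x := by rw [hx, smul_smul, mul_inv_cancel₀ hg0.ne', one_smul]
  have hflatx : ∑ j, (k * blockInner κ x x j) ^ p ≤ k * 50 ^ p := by
    refine le_trans (Finset.sum_le_sum fun j _ => ?_) hflat
    have h0 := blockInner_self_nonneg κ g j
    have h1 : 0 ≤ k * blockInner κ x x j := by
      have := blockInner_self_nonneg κ x j; positivity
    refine pow_le_pow_left₀ h1 ?_ p
    rw [hx, blockInner_smul_smul, PiLp.smul_apply, smul_eq_mul, le_div_iff₀ hp0]
    have h2 : ‖g‖⁻¹ * ‖g‖⁻¹ = (‖g‖ ^ 2)⁻¹ := by rw [← mul_inv, sq]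
    rw [h2, show (k : ℝ) * ((‖g‖ ^ 2)⁻¹ * blockInner κ g g j) * p =
      blockInner κ g g j * (k * p / ‖g‖ ^ 2) by ring]
    exact mul_le_of_le_one_right h0 ((div_le_one (by positivity)).2 (hpd'.trans hg))
  obtain ⟨η, hη⟩ : ∃ η, η = √(L / k) := ⟨_, rfl⟩
  have hη0 : 0 ≤ η := hη ▸ Real.sqrt_nonneg _
  have hηL : k * η ^ 2 = L := by rw [hη, Real.sq_sqrt (by positivity)]; field_simp
  have hηι : 1700 * η ≤ ι := by
    refine le_of_sq_le_sq ?_ hι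
    have : k * (1700 * η) ^ 2 ≤ k * ι ^ 2 := by rw [← hηL] at hkι; linarith
    exact le_of_mul_le_mul_left this hk0
  have hIx : ‖Complex.I • x‖ = 1 := by rw [norm_smul, hx1, Complex.norm_I, one_mul]
  have b1 := stdGaussian_le_abs_norm_sq_blockInner_sub κ hk hx1 hp (by linarith) hLp hflatx
    hη0 hηL
  have b2 := stdGaussian_le_abs_norm_sq_sub_two_mul (d := d) (L := L) (by linarith)
    (by nlinarith)
  have b3 := stdGaussian_le_inner_sq hx1 hL
  have b4 := stdGaussian_le_inner_sq hIx hL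
  have hsub : {h | ¬ GoodPair κ ι g h} ⊆
      (({h | 620 * max η (η ^ 2) ≤ |‖blockInner κ x h‖ ^ 2 - 1|} ∪
        {h | 8 * √(d * L) ≤ |‖h‖ ^ 2 - 2 * d|}) ∪ {h | 9 * L ≤ inner ℝ x h ^ 2}) ∪
        {h | 9 * L ≤ inner ℝ (Complex.I • x) h ^ 2} := by
    intro h hbad
    by_contra hc
    simp only [Set.mem_union, Set.mem_ofPred_eq, not_or, not_le] at hc
    obtain ⟨⟨⟨c1, c2⟩, c3⟩, c4⟩ := hc
    refine hbad ?_
    have e4 : inner ℝ (Complex.I • x) h = (inner ℂ x h).im := by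
      rw [real_inner_eq_re_inner_complex, inner_smul_left]
      simp
    rw [e4] at c4
    rw [real_inner_eq_re_inner_complex] at c3
    have hq : ‖blockInner κ x x‖ ^ 2 ≤ 5000 / k := by
      rw [EuclideanSpace.real_norm_sq_eq]
      exact sum_sq_le_of_sum_pow_le hk hp (blockInner_self_nonneg κ x) hflatx
    have hs : ‖inner ℂ x h‖ ^ 2 ≤ 18 * L := by
      rw [Complex.sq_norm, Complex.normSq_apply]; nlinarith
    have hR : ‖(inner ℂ x h).re • blockInner κ x x‖ ≤ 213 * η := by
      refine le_of_sq_le_sq ?_ (by positivity)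
      rw [norm_smul, mul_pow, Real.norm_eq_abs, sq_abs]
      calc (inner ℂ x h).re ^ 2 * ‖blockInner κ x x‖ ^ 2 ≤ 9 * L * (5000 / k) := by gcongr
        _ = 45000 * η ^ 2 := by rw [← hηL]; field_simp; ring
        _ ≤ (213 * η) ^ 2 := by nlinarith [sq_nonneg η]
    have hdet := abs_sqrt_mul_sub_le (A := ‖blockInner κ x (h - inner ℂ x h • x)‖)
      (W := ‖blockInner κ x h‖) hk1 hL hη0 hηL hd (norm_nonneg _) (norm_nonneg _) c1.le hR
      (by
        rw [blockInner_sub_complex_smul]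
        refine (abs_norm_sub_norm_le _ _).trans (le_of_eq ?_)
        rw [sub_sub_cancel_left, norm_neg])
      c2.le (sq_nonneg _) hs (norm_sq_sub_inner_smul hx1 h)
    rw [hgx]
    refine goodPair_smul κ hx1 hg0 hdet.1 (hdet.2.trans ?_)
    exact mul_le_mul_of_nonneg_right hηι hdet.1.le
  have u1 := measureReal_mono hsub (μ := stdGaussian (EuclideanSpace ℂ (Fin d)))
  refine u1.trans ((measureReal_union_le _ _).trans ?_)
  refine (add_le_add_left ((measureReal_union_le _ _).trans
    (add_le_add_left (measureReal_union_le _ _) _)) _).trans ?_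
  linarith

/-- Two independent Gaussian vectors form a good pair with overwhelming probability. -/
theorem stdGaussian_prod_not_goodPair {L ι : ℝ} (hk : k ≠ 0) (hL : 1 ≤ L) (hι : 0 ≤ ι)
    (hkι : 1700 ^ 2 * L ≤ ι ^ 2 * k) (hd : 676 * k * L ≤ d)
    (hκ : ∀ j, (Finset.univ.filter fun t => κ t = j).card ≤ d / k + 1) :
    ((stdGaussian (EuclideanSpace ℂ (Fin d))).prod (stdGaussian (EuclideanSpace ℂ (Fin d))))
      {z | ¬ GoodPair κ ι z.1 z.2} ≤ ENNReal.ofReal (11 * Real.exp (-L)) := by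
  have hk1 : (1 : ℝ) ≤ k := by exact_mod_cast Nat.one_le_iff_ne_zero.2 hk
  obtain ⟨p, hp⟩ : ∃ p, p = d / k := ⟨_, rfl⟩
  have hpd : k * p ≤ d := hp ▸ Nat.mul_div_le d k
  have hdp : (d : ℝ) < k * (p + 1) := by
    rw [hp]; exact_mod_cast Nat.lt_mul_div_succ d (Nat.pos_of_ne_zero hk)
  have hp676 : 676 * L ≤ p + 1 := by
    have : k * (676 * L) ≤ k * (p + 1 : ℝ) := by linarith
    exact le_of_mul_le_mul_left this (by linarith)
  have hp2 : 2 ≤ p := by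
    have : (2 : ℝ) ≤ p := by linarith
    exact_mod_cast this
  have hLp : L ≤ p := by linarith
  have hmeas := (measurableSet_goodPair κ ι).compl
  have hcompl : {z : EuclideanSpace ℂ (Fin d) × EuclideanSpace ℂ (Fin d) |
      ¬ GoodPair κ ι z.1 z.2} = {z | GoodPair κ ι z.1 z.2}ᶜ := rfl
  rw [hcompl, Measure.prod_apply hmeas]
  refine (lintegral_le_measure_add _ (fun g => prob_le_one)
    ({g | 8 * √(d * L) ≤ |‖g‖ ^ 2 - 2 * d|} ∪
      {g | k * 50 ^ p < ∑ j, (blockInner κ g g j / p) ^ p})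
    (ENNReal.ofReal (8 * Real.exp (-L))) fun g hg => ?_).trans ?_
  · simp only [Set.mem_union, Set.mem_ofPred_eq, not_or, not_le, not_lt] at hg
    obtain ⟨g1, g2⟩ := hg
    have hsq : 8 * √(d * L) ≤ d := by
      have : √(d * L) ≤ d / 8 := by
        refine Real.sqrt_le_iff.2 ⟨by positivity, ?_⟩
        have : 64 * L ≤ d := by nlinarith
        nlinarith
      linarith
    have hgd : d ≤ ‖g‖ ^ 2 := by
      have := (abs_lt.1 g1).1
      linarith
    have := stdGaussian_not_goodPair κ hk hL hι hkι hd hp2 hLp hpd hgd g2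
    exact (ENNReal.le_ofReal_iff_toReal_le (measure_ne_top _ _) (by positivity)).2 this
  · have b1 := stdGaussian_le_abs_norm_sq_sub_two_mul (d := d) (L := L) (by linarith)
      (by nlinarith)
    have b2 := stdGaussian_lt_sum_blockInner_pow κ (p := p) (by omega) hk fun j =>
      (hκ j).trans (by omega)
    have b3 : Real.exp (-p) ≤ Real.exp (-L) := Real.exp_le_exp.2 (by linarith)
    have b4 := (measureReal_union_le _ _).trans (add_le_add b1 (b2.trans b3))
    have b5 := (ENNReal.le_ofReal_iff_toReal_le (measure_ne_top _ _) (by positivity)).2 b4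
    refine (add_le_add_left b5 _).trans ?_
    rw [← ENNReal.ofReal_add (by positivity) (by positivity)]
    exact ENNReal.ofReal_le_ofReal (by linarith)

end GaussianPair

/-! ### From Haar measure on the unitary group to Gaussian vectors -/

section HaarGaussian

open ProbabilityTheory

variable {d k : ℕ}

/-- A unitary matrix as a linear isometry of `ℂ^d`. -/
noncomputable def unitaryIsometry (d : ℕ) : Matrix.unitaryGroup (Fin d) ℂ ≃*
    (EuclideanSpace ℂ (Fin d) ≃ₗᵢ[ℂ] EuclideanSpace ℂ (Fin d)) :=
  (Unitary.mapEquiv 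
    ⟨(Matrix.toEuclideanCLM (𝕜 := ℂ) (n := Fin d)).toRingEquiv.toMulEquiv,
      map_star (Matrix.toEuclideanCLM (𝕜 := ℂ) (n := Fin d))⟩).toMulEquiv.trans
    Unitary.linearIsometryEquiv

theorem unitaryIsometry_inv_apply (U : Matrix.unitaryGroup (Fin d) ℂ)
    (x : EuclideanSpace ℂ (Fin d)) (t : Fin d) :
    unitaryIsometry d U⁻¹ x t = ∑ a, star (U.1 a t) * x a := rfl

theorem continuous_unitaryIsometry_inv : Continuous fun z :
    Matrix.unitaryGroup (Fin d) ℂ × EuclideanSpace ℂ (Fin d) => unitaryIsometry d z.1⁻¹ z.2 := by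
  have h : (fun z : Matrix.unitaryGroup (Fin d) ℂ × EuclideanSpace ℂ (Fin d) =>
      unitaryIsometry d z.1⁻¹ z.2) =
      fun z => WithLp.toLp 2 fun t => ∑ a, star (z.1.1 a t) * z.2 a := rfl
  rw [h]
  refine (PiLp.continuous_toLp 2 _).comp (continuous_pi fun t => ?_)
  refine continuous_finsetSum _ fun a _ => ?_
  exact ((continuous_subtype_val.comp continuous_fst).matrix_elem a t).star.mul
    ((PiLp.continuous_apply 2 _ a).comp continuous_snd)

attribute [irreducible] unitaryIsometry

/-- The unitary group acts transitively on orthonormal pairs. -/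
theorem exists_unitaryIsometry_eq {a b a' b' : EuclideanSpace ℂ (Fin d)} (ha : ‖a‖ = 1)
    (hb : ‖b‖ = 1) (hab : inner ℂ a b = 0) (ha' : ‖a'‖ = 1) (hb' : ‖b'‖ = 1)
    (hab' : inner ℂ a' b' = 0) :
    ∃ V : Matrix.unitaryGroup (Fin d) ℂ, unitaryIsometry d V a = a' ∧
      unitaryIsometry d V b = b' := by
  have hd : 2 ≤ d := by
    have ho : Orthonormal ℂ ![a, b] := by
      rw [orthonormal_iff_ite]
      intro i j
      fin_cases i <;> fin_cases j <;>
        simp [ha, hb, hab, inner_eq_zero_symm.1 hab]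
    have := ho.linearIndependent.fintype_card_le_finrank
    simpa using this
  have hbasis {a b : EuclideanSpace ℂ (Fin d)} (ha : ‖a‖ = 1) (hb : ‖b‖ = 1)
      (hab : inner ℂ a b = 0) : ∃ e : OrthonormalBasis (Fin d) ℂ (EuclideanSpace ℂ (Fin d)),
        e ⟨0, by omega⟩ = a ∧ e ⟨1, by omega⟩ = b := by
    have ho : Orthonormal ℂ (Set.domRestrict {⟨0, by omega⟩, ⟨1, by omega⟩}
        (fun i : Fin d => if i.val = 0 then a else b)) := by
      rw [orthonormal_iff_ite]
      rintro ⟨i, rfl | rfl⟩ ⟨j, rfl | rfl⟩ <;>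
        simp [Set.domRestrict, ha, hb, hab, inner_eq_zero_symm.1 hab, Subtype.ext_iff,
          Fin.ext_iff]
    obtain ⟨e, he⟩ := ho.exists_orthonormalBasis_extension_of_card_eq (by simp)
    refine ⟨e, ?_, ?_⟩
    · rw [he _ (by simp)]; simp
    · rw [he _ (by simp)]; simp
  obtain ⟨e, e0, e1⟩ := hbasis ha hb hab
  obtain ⟨e', e0', e1'⟩ := hbasis ha' hb' hab'
  refine ⟨(unitaryIsometry d).symm (e.equiv e' (Equiv.refl _)), ?_, ?_⟩
  · rw [MulEquiv.apply_symm_apply, ← e0, OrthonormalBasis.equiv_apply_basis, ← e0']; rfl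
  · rw [MulEquiv.apply_symm_apply, ← e1, OrthonormalBasis.equiv_apply_basis, ← e1']; rfl

instance : (haarUnitary d).IsMulLeftInvariant := by unfold haarUnitary; infer_instance

theorem stdGaussian_map_unitaryIsometry (U : Matrix.unitaryGroup (Fin d) ℂ) :
    (stdGaussian (EuclideanSpace ℂ (Fin d))).map (unitaryIsometry d U) =
      stdGaussian (EuclideanSpace ℂ (Fin d)) := by
  let f : EuclideanSpace ℂ (Fin d) ≃ₗᵢ[ℝ] EuclideanSpace ℂ (Fin d) :=
    { (unitaryIsometry d U).toLinearEquiv.restrictScalars ℝ with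
      norm_map' := (unitaryIsometry d U).norm_map }
  exact stdGaussian_map f

/-- If every pair of points is sent into `F` by a random transformation with probability at least
`H`, then two independent points of a law that the transformations preserve form a pair in `F` with
probability at least `H`. -/
theorem le_prod_of_forall_le_of_measurePreserving {G X : Type*} [MeasurableSpace G]
    [MeasurableSpace X] (μ : Measure G) [IsProbabilityMeasure μ] (ρ : Measure X)
    [IsProbabilityMeasure ρ] {T : G → X → X} (hT : Measurable fun z : G × X => T z.1 z.2)
    (hρ : ∀ U, MeasurePreserving (T U) ρ ρ) {F : Set (X × X)} (hF : MeasurableSet F) {H : ENNReal}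
    (h : ∀ x y, H ≤ μ {U | (T U x, T U y) ∈ F}) : H ≤ (ρ.prod ρ) F := by
  have hm : Measurable fun z : G × (X × X) => (T z.1 z.2.1, T z.1 z.2.2) :=
    (hT.comp (measurable_fst.prodMk measurable_snd.fst)).prodMk
      (hT.comp (measurable_fst.prodMk measurable_snd.snd))
  have e1 := Measure.prod_apply (μ := μ) (ν := ρ.prod ρ) (hm hF)
  have e2 := Measure.prod_apply_symm (μ := μ) (ν := ρ.prod ρ) (hm hF)
  have e3 (U : G) : (ρ.prod ρ) (Prod.mk U ⁻¹' ((fun z : G × (X × X) =>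
      (T z.1 z.2.1, T z.1 z.2.2)) ⁻¹' F)) = (ρ.prod ρ) F :=
    ((hρ U).prod (hρ U)).measure_preimage hF.nullMeasurableSet
  simp only [e3, lintegral_const, measure_univ, mul_one] at e1
  rw [← e1, e2]
  calc H = ∫⁻ _, H ∂(ρ.prod ρ) := by rw [lintegral_const, measure_univ, mul_one]
    _ ≤ _ := lintegral_mono fun x => h x.1 x.2

theorem measurePreserving_unitaryIsometry (U : Matrix.unitaryGroup (Fin d) ℂ) :
    MeasurePreserving (unitaryIsometry d U) (stdGaussian (EuclideanSpace ℂ (Fin d)))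
      (stdGaussian (EuclideanSpace ℂ (Fin d))) :=
  ⟨(unitaryIsometry d U).continuous.measurable, stdGaussian_map_unitaryIsometry U⟩

theorem orthPart_map (V : EuclideanSpace ℂ (Fin d) ≃ₗᵢ[ℂ] EuclideanSpace ℂ (Fin d))
    (g h : EuclideanSpace ℂ (Fin d)) : orthPart (V g) (V h) = V (orthPart g h) := by
  simp only [orthPart, map_sub, map_smul, LinearIsometryEquiv.norm_map,
    LinearIsometryEquiv.inner_map_map]
  congr 1
  rw [← Complex.coe_smul, ← Complex.coe_smul, map_smul]

theorem inner_orthPart (g h : EuclideanSpace ℂ (Fin d)) : inner ℂ g (orthPart g h) = 0 := by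
  rw [orthPart, inner_sub_right, inner_smul_right, ← Complex.coe_smul, inner_smul_right,
    inner_self_eq_norm_sq_to_K]
  push_cast
  simp
  ring

/-- Failure of the sketch for a Haar-random orthonormal pair is at most as likely as failure for a
Gaussian pair. -/
theorem haarUnitary_lt_le_stdGaussian (κ : Fin d → Fin k) {a b : EuclideanSpace ℂ (Fin d)}
    (ha : ‖a‖ = 1) (hb : ‖b‖ = 1) (hab : inner ℂ a b = 0) (ι : ℝ) :
    haarUnitary d {U | ι < |√(2 * d) *
      ‖blockInner κ (unitaryIsometry d U⁻¹ a) (unitaryIsometry d U⁻¹ b)‖ - 1|} ≤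
      ((stdGaussian (EuclideanSpace ℂ (Fin d))).prod (stdGaussian (EuclideanSpace ℂ (Fin d))))
        {z | ¬ GoodPair κ ι z.1 z.2} := by
  refine le_prod_of_forall_le_of_measurePreserving (haarUnitary d)
    (stdGaussian (EuclideanSpace ℂ (Fin d))) continuous_unitaryIsometry_inv.measurable
    (fun U => measurePreserving_unitaryIsometry U⁻¹) (measurableSet_goodPair κ ι).compl
    fun g h => ?_
  by_cases hgh : 0 < ‖g‖ ∧ 0 < ‖orthPart g h‖
  · obtain ⟨hg, ho⟩ := hgh
    obtain ⟨V, hVa, hVb⟩ := exists_unitaryIsometry_eq ha hb hab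
      (a' := (‖g‖⁻¹ : ℝ) • g) (b' := (‖orthPart g h‖⁻¹ : ℝ) • orthPart g h)
      (by rw [norm_smul, norm_inv, norm_norm, inv_mul_cancel₀ hg.ne'])
      (by rw [norm_smul, norm_inv, norm_norm, inv_mul_cancel₀ ho.ne'])
      (by
        rw [← Complex.coe_smul, ← Complex.coe_smul, inner_smul_left, inner_smul_right,
          inner_orthPart, mul_zero, mul_zero])
    have hga : g = ‖g‖ • unitaryIsometry d V a := by
      rw [hVa, smul_smul, mul_inv_cancel₀ hg.ne', one_smul]
    have hob : orthPart g h = ‖orthPart g h‖ • unitaryIsometry d V b := by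
      rw [hVb, smul_smul, mul_inv_cancel₀ ho.ne', one_smul]
    rw [← measure_preimage_mul (haarUnitary d) V⁻¹]
    refine measure_mono fun U hU hgood => ?_
    have hU' : ι < |√(2 * d) * ‖blockInner κ (unitaryIsometry d (V⁻¹ * U)⁻¹ a)
      (unitaryIsometry d (V⁻¹ * U)⁻¹ b)‖ - 1| := hU
    have hcomp (x : EuclideanSpace ℂ (Fin d)) : unitaryIsometry d (V⁻¹ * U)⁻¹ x =
        unitaryIsometry d U⁻¹ (unitaryIsometry d V x) := by
      rw [mul_inv_rev, inv_inv, map_mul]; rfl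
    have hsmul (c : ℝ) (x : EuclideanSpace ℂ (Fin d)) :
        unitaryIsometry d U⁻¹ (c • x) = c • unitaryIsometry d U⁻¹ x := by
      rw [← Complex.coe_smul, map_smul, Complex.coe_smul]
    obtain ⟨-, -, h3⟩ : GoodPair κ ι (unitaryIsometry d U⁻¹ g) (unitaryIsometry d U⁻¹ h) := hgood
    rw [orthPart_map, LinearIsometryEquiv.norm_map, LinearIsometryEquiv.norm_map] at h3
    have e : blockInner κ (unitaryIsometry d U⁻¹ g) (unitaryIsometry d U⁻¹ (orthPart g h)) =
        (‖g‖ * ‖orthPart g h‖) • blockInner κ (unitaryIsometry d (V⁻¹ * U)⁻¹ a)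
          (unitaryIsometry d (V⁻¹ * U)⁻¹ b) := by
      rw [hcomp, hcomp, ← blockInner_smul_smul, ← hsmul, ← hsmul, ← hga, ← hob]
    have hpos : 0 < ‖g‖ * ‖orthPart g h‖ := mul_pos hg ho
    rw [e, norm_smul, Real.norm_of_nonneg hpos.le] at h3
    have e2 (A : ℝ) : √(2 * d) * (‖g‖ * ‖orthPart g h‖ * A) - ‖g‖ * ‖orthPart g h‖ =
        ‖g‖ * ‖orthPart g h‖ * (√(2 * d) * A - 1) := by ring
    rw [e2, abs_mul, abs_of_pos hpos, mul_comm ι] at h3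
    exact absurd (le_of_mul_le_mul_left h3 hpos) (not_le.2 hU')
  · -- rotations preserve degenerate pairs, which are never good
    have : {U : Matrix.unitaryGroup (Fin d) ℂ | (unitaryIsometry d U⁻¹ g,
        unitaryIsometry d U⁻¹ h) ∈ {z : EuclideanSpace ℂ (Fin d) × EuclideanSpace ℂ (Fin d) |
          GoodPair κ ι z.1 z.2}ᶜ} = Set.univ := by
      refine Set.eq_univ_of_forall fun U hgood => hgh ?_
      obtain ⟨h1, h2, -⟩ : GoodPair κ ι (unitaryIsometry d U⁻¹ g) (unitaryIsometry d U⁻¹ h) :=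
        hgood
      rw [LinearIsometryEquiv.norm_map] at h1
      rw [orthPart_map, LinearIsometryEquiv.norm_map] at h2
      exact ⟨h1, h2⟩
    rw [this, measure_univ]
    exact prob_le_one

end HaarGaussian

/-! ### The sketch of two pure states -/

section Sketch

variable {d k : ℕ}

theorem probVec_sketchMeasurement [NeZero k] (U : Matrix.unitaryGroup (Fin d) ℂ)
    (φ : EuclideanSpace ℂ (Fin d)) :
    (sketchMeasurement k U).probVec φ = blockInner (fun t : Fin d => Fin.ofNat k t.val)
      (unitaryIsometry d U⁻¹ φ) (unitaryIsometry d U⁻¹ φ) := by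
  ext j
  simp only [Measurement.probVec, Measurement.prob, sketchMeasurement, blockInner,
    Matrix.sum_mulVec, dotProduct_sum, Complex.re_sum]
  refine Finset.sum_congr rfl fun t _ => ?_
  have h1 : (Matrix.vecMulVec (U.1.col t) (star (U.1.col t))).mulVec φ.ofLp =
      (star (U.1.col t) ⬝ᵥ φ.ofLp) • U.1.col t := by
    rw [Matrix.vecMulVec_mulVec, op_smul_eq_smul]
  have h2 : unitaryIsometry d U⁻¹ φ t = star (U.1.col t) ⬝ᵥ φ.ofLp :=
    unitaryIsometry_inv_apply U φ t
  have h3 : star φ.ofLp ⬝ᵥ U.1.col t = star (star (U.1.col t) ⬝ᵥ φ.ofLp) := by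
    rw [Matrix.star_dotProduct]
  rw [columnProj, h1, dotProduct_smul, h3, h2, real_inner_self_eq_norm_sq, smul_eq_mul,
    Complex.sq_norm, Complex.normSq_apply, Complex.star_def, Complex.mul_re, Complex.conj_re,
    Complex.conj_im]
  ring

theorem blockInner_self_sub_self (κ : Fin d → Fin k) (x y : EuclideanSpace ℂ (Fin d)) :
    blockInner κ x x - blockInner κ y y = blockInner κ (x + y) (x - y) := by
  ext j
  simp only [blockInner, PiLp.sub_apply, PiLp.add_apply, ← Finset.sum_sub_distrib,
    inner_add_left, inner_sub_right]
  refine Finset.sum_congr rfl fun t _ => ?_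
  rw [real_inner_comm (x t) (y t)]
  ring

theorem blockInner_complex_smul_self (κ : Fin d → Fin k) {u : ℂ} (hu : ‖u‖ = 1)
    (x : EuclideanSpace ℂ (Fin d)) : blockInner κ (u • x) (u • x) = blockInner κ x x := by
  ext j
  simp only [blockInner, PiLp.smul_apply, smul_eq_mul, real_inner_self_eq_norm_sq, norm_mul, hu,
    one_mul]

theorem traceDistance_nonneg (φ ψ : EuclideanSpace ℂ (Fin d)) : 0 ≤ traceDistance φ ψ :=
  Real.sqrt_nonneg _

theorem exists_norm_eq_one_mul_inner_eq_norm (φ ψ : EuclideanSpace ℂ (Fin d)) :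
    ∃ u : ℂ, ‖u‖ = 1 ∧ inner ℂ ψ (u • φ) = (‖inner ℂ ψ φ‖ : ℂ) := by
  rcases eq_or_ne (inner ℂ ψ φ) 0 with h | h
  · exact ⟨1, norm_one, by rw [one_smul, h]; simp⟩
  · have h0 : (‖inner ℂ ψ φ‖ : ℂ) ≠ 0 := by simpa using h
    refine ⟨star (inner ℂ ψ φ) / ‖inner ℂ ψ φ‖, ?_, ?_⟩
    · rw [norm_div, norm_star, Complex.norm_real, norm_norm, div_self (norm_ne_zero_iff.2 h)]
    · rw [inner_smul_right, div_mul_eq_mul_div, Complex.star_def, mul_comm, Complex.mul_conj,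
        Complex.normSq_eq_norm_sq]
      push_cast
      rw [sq, mul_div_assoc, div_self h0, mul_one]

/-- After a choice of phase, `φφ† - ψψ† = (στ† + τσ†) / 2` with the orthogonal vectors `σ = φ + ψ`
and `τ = φ - ψ`. -/
theorem exists_orthogonal_blockInner_sub {φ ψ : EuclideanSpace ℂ (Fin d)} (hφ : ‖φ‖ = 1)
    (hψ : ‖ψ‖ = 1) :
    ∃ σ τ : EuclideanSpace ℂ (Fin d), inner ℂ σ τ = 0 ∧ ‖σ‖ * ‖τ‖ = 2 * traceDistance φ ψ ∧
      ∀ (κ : Fin d → Fin k)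
        (W : EuclideanSpace ℂ (Fin d) ≃ₗᵢ[ℂ] EuclideanSpace ℂ (Fin d)),
        blockInner κ (W φ) (W φ) - blockInner κ (W ψ) (W ψ) = blockInner κ (W σ) (W τ) := by
  obtain ⟨u, hu, huφ⟩ := exists_norm_eq_one_mul_inner_eq_norm φ ψ
  obtain ⟨r, hr⟩ : ∃ r, r = ‖inner ℂ ψ φ‖ := ⟨_, rfl⟩
  rw [← hr] at huφ
  have hr1 : r ≤ 1 := by
    rw [hr]; exact (norm_inner_le_norm ψ φ).trans (by rw [hφ, hψ, one_mul])
  have hr0 : 0 ≤ r := hr ▸ norm_nonneg _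
  have huφ' : inner ℂ (u • φ) ψ = (r : ℂ) := by
    rw [← inner_conj_symm, huφ, Complex.conj_ofReal]
  have hn : ‖u • φ‖ = 1 := by rw [norm_smul, hu, hφ, one_mul]
  refine ⟨u • φ + ψ, u • φ - ψ, ?_, ?_, fun κ W => ?_⟩
  · rw [inner_add_left, inner_sub_right, inner_sub_right, huφ, huφ',
      inner_self_eq_norm_sq_to_K, inner_self_eq_norm_sq_to_K, hn, hψ]
    ring
  · have h1 : ‖u • φ + ψ‖ ^ 2 = 2 + 2 * r := by
      rw [norm_add_sq (𝕜 := ℂ), huφ', hn, hψ]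
      simp
      ring
    have h2 : ‖u • φ - ψ‖ ^ 2 = 2 - 2 * r := by
      rw [norm_sub_sq (𝕜 := ℂ), huφ', hn, hψ]
      simp
      ring
    rw [← sq_eq_sq₀ (by positivity) (mul_nonneg zero_le_two (traceDistance_nonneg φ ψ)), mul_pow,
      mul_pow, h1, h2, traceDistance, ← hr, Real.sq_sqrt (by nlinarith)]
    ring
  · rw [← blockInner_complex_smul_self κ hu (W φ), ← map_smul, blockInner_self_sub_self, map_add,
      map_sub]

theorem card_filter_ofNat_eq_le [NeZero k] (j : Fin k) :
    (Finset.univ.filter fun t : Fin d => Fin.ofNat k t.val = j).card ≤ d / k + 1 := by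
  have hk : 0 < k := Nat.pos_of_ne_zero (NeZero.ne k)
  have h1 : (Finset.univ.filter fun t : Fin d => Fin.ofNat k t.val = j).card ≤
      Nat.count (fun x => x ≡ j.val [MOD k]) d := by
    rw [Nat.count_eq_card_filter_range]
    refine Finset.card_le_card_of_injOn Fin.val (fun t ht => ?_) Fin.val_injective.injOn
    have ht' : Fin.ofNat k t.val = j := by simpa using ht
    simp only [Finset.coe_filter, Finset.mem_range, Set.mem_ofPred_eq]
    refine ⟨t.isLt, ?_⟩
    rw [← ht']
    simp [Nat.ModEq]
  refine h1.trans ?_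
  rw [Nat.count_modEq_card _ hk]
  split_ifs <;> omega

/-- The exact outcome distributions of a Haar-random sketch measurement preserve the distance of
two pure states up to a factor `1 ± ι`. -/
theorem haarUnitary_lt_abs_norm_probVec_sub [NeZero k] {φ ψ : EuclideanSpace ℂ (Fin d)}
    (hφ : ‖φ‖ = 1) (hψ : ‖ψ‖ = 1) {L ι : ℝ} (hL : 1 ≤ L) (hι : 0 ≤ ι)
    (hkι : 1700 ^ 2 * L ≤ ι ^ 2 * k) (hd : 676 * k * L ≤ d) :
    haarUnitary d {U | ι * traceDistance φ ψ < |√(d / 2) *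
      ‖(sketchMeasurement k U).probVec φ - (sketchMeasurement k U).probVec ψ‖ -
        traceDistance φ ψ|} ≤ ENNReal.ofReal (11 * Real.exp (-L)) := by
  obtain ⟨σ, τ, hστ, hnorm, hB⟩ := exists_orthogonal_blockInner_sub (k := k) hφ hψ
  obtain ⟨D, hD⟩ : ∃ D, D = traceDistance φ ψ := ⟨_, rfl⟩
  have hD0 : 0 ≤ D := hD ▸ traceDistance_nonneg φ ψ
  have hsqrt : √(d / 2 : ℝ) = √(2 * d) / 2 := by
    rw [show (d / 2 : ℝ) = 2 * d / 2 ^ 2 by ring, Real.sqrt_div (by positivity),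
      Real.sqrt_sq (by norm_num)]
  simp only [probVec_sketchMeasurement, hB]
  rw [← hD] at hnorm ⊢
  set κ : Fin d → Fin k := fun t => Fin.ofNat k t.val
  rcases hD0.eq_or_lt with h0 | h0
  · -- both sides of the inequality vanish, as `σ = 0` or `τ = 0`
    have hz (U : Matrix.unitaryGroup (Fin d) ℂ) :
        blockInner κ (unitaryIsometry d U⁻¹ σ) (unitaryIsometry d U⁻¹ τ) = 0 := by
      rw [← h0, mul_zero, mul_eq_zero, norm_eq_zero, norm_eq_zero] at hnorm
      rcases hnorm with h | h <;> · ext j; simp [h, blockInner]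
    simp only [hz, ← h0, norm_zero, mul_zero, sub_zero, abs_zero, lt_irrefl]
    simp
  · have hσ : ‖σ‖ ≠ 0 := fun h => by rw [h, zero_mul] at hnorm; linarith
    have hτ : ‖τ‖ ≠ 0 := fun h => by rw [h, mul_zero] at hnorm; linarith
    have ha : ‖(‖σ‖⁻¹ : ℝ) • σ‖ = 1 := by rw [norm_smul, norm_inv, norm_norm, inv_mul_cancel₀ hσ]
    have hb : ‖(‖τ‖⁻¹ : ℝ) • τ‖ = 1 := by rw [norm_smul, norm_inv, norm_norm, inv_mul_cancel₀ hτ]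
    have hab : inner ℂ ((‖σ‖⁻¹ : ℝ) • σ) ((‖τ‖⁻¹ : ℝ) • τ) = 0 := by
      rw [← Complex.coe_smul, ← Complex.coe_smul, inner_smul_left, inner_smul_right, hστ,
        mul_zero, mul_zero]
    refine le_trans (measure_mono fun U hU => ?_) ((haarUnitary_lt_le_stdGaussian κ ha hb hab
      ι).trans (stdGaussian_prod_not_goodPair κ (NeZero.ne k) hL hι hkι hd
        card_filter_ofNat_eq_le))
    have hU' : ι * D < |√(d / 2) * ‖blockInner κ (unitaryIsometry d U⁻¹ σ)
      (unitaryIsometry d U⁻¹ τ)‖ - D| := hU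
    have hsmul (c : ℝ) (x : EuclideanSpace ℂ (Fin d)) :
        unitaryIsometry d U⁻¹ (c • x) = c • unitaryIsometry d U⁻¹ x := by
      rw [← Complex.coe_smul, map_smul, Complex.coe_smul]
    simp only [Set.mem_ofPred_eq]
    rw [hsmul, hsmul, blockInner_smul_smul, norm_smul, ← mul_inv, hnorm,
      Real.norm_of_nonneg (by positivity)]
    have e : √(d / 2) * ‖blockInner κ (unitaryIsometry d U⁻¹ σ) (unitaryIsometry d U⁻¹ τ)‖ - D =
        (√(2 * d) * ((2 * D)⁻¹ * ‖blockInner κ (unitaryIsometry d U⁻¹ σ)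
          (unitaryIsometry d U⁻¹ τ)‖) - 1) * D := by
      rw [hsqrt]; field_simp
    rw [e, abs_mul, abs_of_pos h0] at hU'
    exact lt_of_mul_lt_mul_right hU' h0.le

/-- If the empirical distributions are within `ε / √(2d)` of the exact ones, then they inherit the
distance estimate with an additive error `ε`. -/
theorem le_and_le_of_norm_sub_lt {x y p q : EuclideanSpace ℝ (Fin k)} {D ι ε : ℝ} (hd : d ≠ 0)
    (hx : ‖x - p‖ < ε / √(2 * d)) (hy : ‖y - q‖ < ε / √(2 * d))
    (h : |√(d / 2) * ‖p - q‖ - D| ≤ ι * D) :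
    (1 - ι) * D - ε ≤ √(d / 2) * ‖x - y‖ ∧ √(d / 2) * ‖x - y‖ ≤ (1 + ι) * D + ε := by
  have hd0 : (0 : ℝ) < d := by exact_mod_cast Nat.pos_of_ne_zero hd
  have hs : 0 < √(2 * d : ℝ) := Real.sqrt_pos.2 (by positivity)
  have hsqrt : √(d / 2 : ℝ) = √(2 * d) / 2 := by
    rw [show (d / 2 : ℝ) = 2 * d / 2 ^ 2 by ring, Real.sqrt_div (by positivity),
      Real.sqrt_sq (by norm_num)]
  have h1 : |‖x - y‖ - ‖p - q‖| ≤ 2 * (ε / √(2 * d)) := by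
    refine (abs_norm_sub_norm_le _ _).trans ?_
    rw [show x - y - (p - q) = (x - p) - (y - q) by abel]
    exact (norm_sub_le _ _).trans (by linarith)
  have h2 : |√(d / 2) * ‖x - y‖ - √(d / 2) * ‖p - q‖| ≤ ε := by
    rw [← mul_sub, abs_mul, abs_of_nonneg (Real.sqrt_nonneg _)]
    calc _ ≤ √(d / 2) * (2 * (ε / √(2 * d))) := by gcongr
      _ = ε := by rw [hsqrt]; field_simp
  obtain ⟨a1, a2⟩ := abs_le.1 h
  obtain ⟨b1, b2⟩ := abs_le.1 h2
  constructor <;> linarith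

theorem pairLaw_le_norm_empirical_sub (M : Measurement d k) {N : ℕ} (hN : N ≠ 0)
    {φ ψ : EuclideanSpace ℂ (Fin d)} (hφ : ‖φ‖ = 1) (hψ : ‖ψ‖ = 1) {r : ℝ} (hr : 0 ≤ r) :
    pairLaw M N φ ψ ({z | r ≤ ‖empirical z.1 - M.probVec φ‖} ∪
      {z | r ≤ ‖empirical z.2 - M.probVec ψ‖}) ≤
      ENNReal.ofReal (4 * Real.exp (-(r ^ 2 * N / 4))) := by
  have := M.isProbabilityMeasure_sampleLaw N hφ
  have := M.isProbabilityMeasure_sampleLaw N hψ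
  refine (measure_union_le _ _).trans ?_
  have e1 : {z : (Fin N → Fin k) × (Fin N → Fin k) | r ≤ ‖empirical z.1 - M.probVec φ‖} =
      {x | r ≤ ‖empirical x - M.probVec φ‖} ×ˢ Set.univ := by ext; simp
  have e2 : {z : (Fin N → Fin k) × (Fin N → Fin k) | r ≤ ‖empirical z.2 - M.probVec ψ‖} =
      Set.univ ×ˢ {x | r ≤ ‖empirical x - M.probVec ψ‖} := by ext; simp
  rw [e1, e2, pairLaw, Measure.prod_prod, Measure.prod_prod, measure_univ, measure_univ, mul_one,
    one_mul]
  refine (add_le_add (M.sampleLaw_le_norm_empirical_sub hN hφ hr)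
    (M.sampleLaw_le_norm_empirical_sub hN hψ hr)).trans ?_
  rw [← ENNReal.ofReal_add (by positivity) (by positivity)]
  exact ENNReal.ofReal_le_ofReal (by linarith)

theorem sketchLaw_not_le [NeZero k] {φ ψ : EuclideanSpace ℂ (Fin d)} (hφ : ‖φ‖ = 1)
    (hψ : ‖ψ‖ = 1) {N : ℕ} {L ι ε : ℝ} (hL : 1 ≤ L) (hι : 0 ≤ ι) (hε : 0 < ε)
    (hkι : 1700 ^ 2 * L ≤ ι ^ 2 * k) (hd : 676 * k * L ≤ d) (hN : 8 * d * L ≤ ε ^ 2 * N) :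
    sketchLaw k N φ ψ
      {z | (1 - ι) * traceDistance φ ψ - ε ≤ √(d / 2) * ‖empirical z.1 - empirical z.2‖ ∧
        √(d / 2) * ‖empirical z.1 - empirical z.2‖ ≤ (1 + ι) * traceDistance φ ψ + ε}ᶜ ≤
      ENNReal.ofReal (15 * Real.exp (-L)) := by
  have hk1 : (1 : ℝ) ≤ k := by exact_mod_cast Nat.one_le_iff_ne_zero.2 (NeZero.ne k)
  have hd0 : (0 : ℝ) < d := by nlinarith
  have hdne : d ≠ 0 := by rintro rfl; simp at hd0
  have hNne : N ≠ 0 := by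
    rintro rfl
    rw [Nat.cast_zero, mul_zero] at hN
    have : 0 < 8 * d * L := by positivity
    linarith
  set G : Set ((Fin N → Fin k) × (Fin N → Fin k)) :=
    {z | (1 - ι) * traceDistance φ ψ - ε ≤ √(d / 2) * ‖empirical z.1 - empirical z.2‖ ∧
        √(d / 2) * ‖empirical z.1 - empirical z.2‖ ≤ (1 + ι) * traceDistance φ ψ + ε} with hG
  have hpair (U : Matrix.unitaryGroup (Fin d) ℂ) :
      pairLaw (sketchMeasurement k U) N φ ψ Gᶜ ≤ 1 := by
    have := (sketchMeasurement k U).isProbabilityMeasure_sampleLaw N hφ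
    have := (sketchMeasurement k U).isProbabilityMeasure_sampleLaw N hψ
    unfold pairLaw
    exact prob_le_one
  rw [sketchLaw, Measure.bind_apply (Set.toFinite _).measurableSet
    (measurable_pairLaw k N).aemeasurable]
  refine (lintegral_le_measure_add _ hpair _ (ENNReal.ofReal (4 * Real.exp (-L)))
    fun U hU => ?_).trans ((add_le_add_left
      (haarUnitary_lt_abs_norm_probVec_sub hφ hψ hL hι hkι hd) _).trans ?_)
  · have hU' : |√(d / 2) * ‖(sketchMeasurement k U).probVec φ -
        (sketchMeasurement k U).probVec ψ‖ - traceDistance φ ψ| ≤ ι * traceDistance φ ψ :=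
      not_lt.1 hU
    have hr : 0 ≤ ε / √(2 * d) := by positivity
    refine (measure_mono fun z hz => ?_).trans
      ((pairLaw_le_norm_empirical_sub (sketchMeasurement k U) hNne hφ hψ hr).trans ?_)
    · by_contra hc
      simp only [Set.mem_union, Set.mem_ofPred_eq, not_or, not_le] at hc
      exact hz (le_and_le_of_norm_sub_lt hdne hc.1 hc.2 hU')
    · refine ENNReal.ofReal_le_ofReal ?_
      gcongr
      rw [div_pow, Real.sq_sqrt (by positivity), div_mul_eq_mul_div, div_div,
        le_div_iff₀ (by positivity)]
      linarith
  · rw [← ENNReal.ofReal_add (by positivity) (by positivity)]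
    exact ENNReal.ofReal_le_ofReal (by linarith)

end Sketch

theorem corollary4p4 (δ₀ : ℝ) (hδ₀ : δ₀ < 1) :
    ∃ c > (0 : ℝ), ∃ c_d > (0 : ℝ), ∃ c_s > (0 : ℝ),
      ∀ (ι δ ε : ℝ), 0 < ι → 0 < δ → δ ≤ δ₀ → 0 < ε →
      ∀ (d k N : ℕ) [NeZero k],
        c * Real.log (1 / δ) / ι ^ 2 ≤ k →
        c_d * k * Real.log (1 / δ) ≤ d →
        c_s * d * Real.log (1 / δ) / ε ^ 2 ≤ N →
      ∀ φ ψ : EuclideanSpace ℂ (Fin d), ‖φ‖ = 1 → ‖ψ‖ = 1 →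
        ENNReal.ofReal (1 - δ) ≤ sketchLaw k N φ ψ
          {z | (1 - ι) * traceDistance φ ψ - ε ≤ √(d / 2) * ‖empirical z.1 - empirical z.2‖ ∧
            √(d / 2) * ‖empirical z.1 - empirical z.2‖ ≤ (1 + ι) * traceDistance φ ψ + ε} := by
  -- the maximum makes the logarithm below positive also when `δ₀ ≤ 0`
  obtain ⟨m, hm⟩ : ∃ m, m = max δ₀ (1 / 2) := ⟨_, rfl⟩
  have hm0 : 0 < m := hm ▸ lt_max_of_lt_right (by norm_num)
  have hm1 : m < 1 := hm ▸ max_lt hδ₀ (by norm_num)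
  obtain ⟨l, hl⟩ : ∃ l, l = Real.log (1 / m) := ⟨_, rfl⟩
  have hl0 : 0 < l := hl ▸ Real.log_pos ((one_lt_div hm0).2 hm1)
  -- `B * log (1 / δ)` is at least `log (1 / δ) + 6`, and `exp (-6)` absorbs the constant `15` of
  -- the failure probability
  obtain ⟨B, hB⟩ : ∃ B, B = 1 + 6 / l := ⟨_, rfl⟩
  have hB0 : 0 < B := hB ▸ by positivity
  refine ⟨1700 ^ 2 * B, by positivity, 676 * B, by positivity, 8 * B, by positivity, ?_⟩
  intro ι δ ε hι hδ hδδ₀ hε d k N _ hk hd hN φ ψ hφ hψ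
  have hlog : l ≤ Real.log (1 / δ) := by
    rw [hl]
    have : δ ≤ m := hδδ₀.trans (hm ▸ le_max_left _ _)
    exact Real.log_le_log (by positivity) (one_div_le_one_div_of_le hδ this)
  obtain ⟨L, hL⟩ : ∃ L, L = Real.log (1 / δ) + 6 := ⟨_, rfl⟩
  have hLB : L ≤ B * Real.log (1 / δ) := by
    have : 6 ≤ 6 / l * Real.log (1 / δ) := by
      rw [div_mul_eq_mul_div, le_div_iff₀ hl0]; linarith
    rw [hL, hB]; linarith
  have hexp : 15 * Real.exp (-L) ≤ δ := by
    have h1 : Real.exp (-L) = δ * Real.exp (-6) := by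
      rw [hL, neg_add, Real.exp_add, one_div, Real.log_inv, neg_neg, Real.exp_log hδ]
    have h2 : 15 * Real.exp (-6) ≤ 1 := by
      have := Real.quadratic_le_exp_of_nonneg (x := 6) (by norm_num)
      rw [Real.exp_neg, ← div_eq_mul_inv, div_le_one (Real.exp_pos _)]
      linarith
    rw [h1]
    nlinarith
  rw [div_le_iff₀ (by positivity)] at hk hN
  have := isProbabilityMeasure_sketchLaw k N hφ hψ
  have hbad := (sketchLaw_not_le (k := k) hφ hψ (N := N) (L := L) (by linarith) hι.le hε
    (by nlinarith) (by
      have : (676 * k : ℝ) * L ≤ 676 * k * (B * Real.log (1 / δ)) := by gcongr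
      linarith) (by
      have : (8 * d : ℝ) * L ≤ 8 * d * (B * Real.log (1 / δ)) := by gcongr
      linarith)).trans (ENNReal.ofReal_le_ofReal hexp)
  rw [ENNReal.ofReal_sub _ hδ.le, ENNReal.ofReal_one, tsub_le_iff_right,
    ← measure_univ (μ := sketchLaw k N φ ψ)]
  exact (measure_univ_le_add_compl _).trans (add_le_add_right hbad _)
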